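/- Let $\Sigma$ be a finite alphabet, $f\ge 1$ an integer, $M$ a finite monoid and $h\colon\Sigma^*\to M$ a monoid homomorphism (given by the multiplication table of $M$ and the values $h(a)$, $a\in\Sigma$). For a tuple put $h(w_1,\dots,w_d)=(h(w_1),\dots,h(w_d))$. **Grammars.** An *extended grammar* has a set of nonterminals $A$ with fan-outs $\mu(A)$, a start symbol $S$, and rules of the forms $S\to A$ (start), $A\to(a)$ with $a\in\Sigma$ (terminal), $A\to\rho(B,C)$ (binary) and $A\to B$ (unit), where $\rho=(\alpha_1,\dots,\alpha_{\mu(A)})$ is a *linear nondeleting template*: the $\alpha_i$ are words over $\Sigma\cup\{x^1,\dots,x^{\mu(B)},y^1,\dots,y^{\mu(C)}\}$ and every variable occurs exactly once in the whole tuple. A binary rule derives from $A$ the tuple $\rho(\vec u,\vec v)$, obtained by substituting $u_i$ for $x^i$ and $v_j$ for $y^j$, whenever $B$ derives $\vec u$ and $C$ derives $\vec v$. $L(G)$ is the set of words derived from $S$. A *working binary linear nondeleting MCFG* is such a grammar with finitely many nonterminals and rules, without unit rules, with $\mu\ge1$, $\mu(S)=1$, with $\mu(A)=1$ in start rules $S\to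 A$ and terminal rules $A\to(a)$, and in which $S$ is not the left-hand side of a terminal or binary rule and occurs on no right-hand side. It is *reduced* if every nonterminal is reachable from $S$ and derives some tuple. **The class.** A *sentence context of arity $d$* is a word $E=u_0\square_{\sigma(1)}u_1\cdots\square_{\sigma(d)}u_d$ with $\sigma\in S_d$ and $u_i\in\Sigma^*$; $E[\vec w]$ is the word obtained by putting $w_i$ for $\square_i$, and $\mathcal D_L(\vec x)$ is the set of contexts $E$ of arity $d$ with $E[\vec x]\in L$. $\mathcal C(f,h)$ is the class of all $L\subseteq\Sigma^*$ such that (i) $L=L(G)$ for some reduced working binary linear nondeleting MCFG $G$ with $\mu(A)\le f$ for all nonterminals $A$, and (ii) for all $1\le d\le f$ and $\vec x,\vec y\in(\Sigma^*)^d$ with $h(\vec x)=h(\vec y)$ and $\mathcal D_L(\vec x)\cap\mathcal D_L(\vec y)\ne\emptyset$ one has $\mathcal D_L(\vec x)=\mathcal D_L(\vec y)$. **Interface types.** The interface type of $E$ is $\tau_h(E)=(\sigma;h(u_0),\dots,h(u_d))\in S_d\times M^{d+1}$. For a linear nondeleting template $\rho=(\alpha_1,\dots,\alpha_e)$ with child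 arities $d_B,d_C$, an interface type $\tau=(\sigma;m_0,\dots,m_e)$ and $\mathbf r\in M^{d_C}$, form the word $m_0\,\alpha'_{\sigma(1)}\,m_1\cdots\alpha'_{\sigma(e)}\,m_e$, where $\alpha'_i$ arises from $\alpha_i$ by replacing each $a\in\Sigma$ by $h(a)$ and each $y^j$ by $r_j$; then $\mathrm{IT}^\rho_B(\tau,\mathbf r)=(\kappa;n_0,\dots,n_{d_B})$, where $x^{\kappa(1)},\dots,x^{\kappa(d_B)}$ is the left-to-right order of the $x$-variables in it and $n_0,\dots,n_{d_B}$ are the products in $M$ of the blocks before, between and after them. $\mathrm{IT}^\rho_C(\tau,\mathbf q)$ for $\mathbf q\in M^{d_B}$ is defined in the same way with the roles of the $x$- and $y$-variables exchanged. **The learner grammar.** Let $K\subseteq\Sigma^*$ be finite. A *typed tuple* $[\vec x:\tau]$ with $\vec x\in(\Sigma^*)^d$, $1\le d\le f$, is *observed in $K$ via $E$* if $E$ is a sentence context of arity $d$ with $E[\vec x]\in K$ and $\tau_h(E)=\tau$. The extended grammar $\hat G(K)$ has a fresh start symbol $\hat S$ of fan-out $1$, the typed tuples $[\vec x:\tau]$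 observed in $K$ as its other nonterminals, the fan-out of $[\vec x:\tau]$ being the arity of $\vec x$, and the following rules: 1. $\hat S\to[(w):\tau_h(\square_1)]$ for $w\in K$; 2. $[(a):\tau]\to(a)$ for every observed $[(a):\tau]$ with $a\in\Sigma$; 3. $[\vec z:\tau]\to\rho([\vec x:\tau_B],[\vec y:\tau_C])$ for all observed typed tuples $[\vec z:\tau],[\vec x:\tau_B],[\vec y:\tau_C]$ and all linear nondeleting templates $\rho$ of matching arities with $\vec z=\rho(\vec x,\vec y)$, $\tau_B=\mathrm{IT}^\rho_B(\tau,h(\vec y))$ and $\tau_C=\mathrm{IT}^\rho_C(\tau,h(\vec x))$; 4. $[\vec x:\tau]\to[\vec y:\tau]$ whenever $h(\vec x)=h(\vec y)$, $\vec x$ and $\vec y$ have the same arity, and $[\vec x:\tau]$, $[\vec y:\tau]$ are observed in $K$ via one and the same context $E$. **Claim.** For every $f\ge1$ and every such $h$, the class $\mathcal C(f,h)$ is identifiable in the limit from positive data by the order-independent learner $\mathcal A(w_1,\dots,w_n)=\hat G(\{w_1,\dots,w_n\})$. That is, $\mathcal A$ is a computable function (from the finite sequence one can compute the finite lists of nonterminals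 with their fan-outs and of rules, and the start symbol, of the finite grammar $\hat G(\{w_1,\dots,w_n\})$), and for every $L\in\mathcal C(f,h)$ and every sequence $(w_i)_{i\ge1}$ of elements of $L$ in which every element of $L$ appears, there is $n_0$ such that $L(\mathcal A(w_1,\dots,w_n))=L$ for all $n\ge n_0$. -/

import Mathlib

namespace TupleLearning

/-! Indices of components, holes and variables start at `0`.  A word is a `List α`, a `d`-tuple of
words is a list of length `d`. -/

/-- Symbols of a rule template: terminals, variables `x i` of the first child and variables `y j`
of the second child. -/
inductive TSym (α : Type*) where
  | letter (a : α)
  | x (i : ℕ)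
  | y (j : ℕ)

/-- A template tuple `(α₁, …, αₑ)`. -/
abbrev Template (α : Type*) := List (List (TSym α))

/-- Rules of an extended grammar; the left-hand side of `start A` is the start symbol. -/
inductive Rule (α N : Type*) where
  | start (A : N)
  | terminal (A : N) (a : α)
  | binary (A : N) (ρ : Template α) (B C : N)
  | unit (A B : N)

/-- A (possibly extended) grammar with terminals in `α` and nonterminals taken from `N`. -/
structure Grammar (α N : Type*) where
  nonterms : Set N
  start : N
  fanout : N → ℕ
  rules : Set (Rule α N)

section Templates

variable {α : Type*}

/-- The indices of the `x`-variables of a template word, from left to right. -/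
def xVars (w : List (TSym α)) : List ℕ :=
  w.filterMap fun s => match s with
    | TSym.x i => some i
    | _ => none

/-- The indices of the `y`-variables of a template word, from left to right. -/
def yVars (w : List (TSym α)) : List ℕ :=
  w.filterMap fun s => match s with
    | TSym.y j => some j
    | _ => none

/-- `ρ` is an `e`-tuple of words over the terminals and the variables
`x 0, …, x (dB - 1), y 0, …, y (dC - 1)`, each of which occurs exactly once in the whole tuple. -/
def IsTemplate (e dB dC : ℕ) (ρ : Template α) : Prop :=
  ρ.length = e ∧ (xVars ρ.flatten).Perm (List.range dB) ∧ (yVars ρ.flatten).Perm (List.range dC)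

/-- Simultaneous substitution in a template word. -/
def substWord (u v : List (List α)) (w : List (TSym α)) : List α :=
  w.flatMap fun s => match s with
    | TSym.letter a => [a]
    | TSym.x i => u.getD i []
    | TSym.y j => v.getD j []

/-- The tuple `ρ(u, v)`. -/
def applyTemplate (ρ : Template α) (u v : List (List α)) : List (List α) :=
  ρ.map (substWord u v)

end Templates

namespace Grammar

variable {α N : Type*} (G : Grammar α N)

/-- `G.Derives A u`: the tuple `u` of terminal words is derivable from `A`. -/
inductive Derives : N → List (List α) → Prop
  | start {A : N} {u : List (List α)} :
      Rule.start A ∈ G.rules → Derives A u → Derives G.start u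
  | terminal {A : N} {a : α} : Rule.terminal A a ∈ G.rules → Derives A [[a]]
  | binary {A B C : N} {ρ : Template α} {u v : List (List α)} :
      Rule.binary A ρ B C ∈ G.rules → Derives B u → Derives C v →
      Derives A (applyTemplate ρ u v)
  | unit {A B : N} {u : List (List α)} :
      Rule.unit A B ∈ G.rules → Derives B u → Derives A u

/-- The string language `L(G)`. -/
def language : Language α := {w | G.Derives G.start [w]}

/-- The conditions on a single rule of a working grammar. -/
def IsWorkingRule : Rule α N → Prop
  | Rule.start A => A ∈ G.nonterms ∧ A ≠ G.start ∧ G.fanout A = 1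
  | Rule.terminal A _ => A ∈ G.nonterms ∧ A ≠ G.start ∧ G.fanout A = 1
  | Rule.binary A ρ B C =>
      A ∈ G.nonterms ∧ B ∈ G.nonterms ∧ C ∈ G.nonterms ∧
      A ≠ G.start ∧ B ≠ G.start ∧ C ≠ G.start ∧
      IsTemplate (G.fanout A) (G.fanout B) (G.fanout C) ρ
  | Rule.unit _ _ => False

/-- Working (start-separated) binary linear nondeleting MCFGs. -/
structure IsWorking : Prop where
  finite_nonterms : G.nonterms.Finite
  finite_rules : G.rules.Finite
  start_mem : G.start ∈ G.nonterms
  fanout_start : G.fanout G.start = 1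
  fanout_pos : ∀ A ∈ G.nonterms, 0 < G.fanout A
  working_rules : ∀ r ∈ G.rules, G.IsWorkingRule r

/-- `B` occurs on the right-hand side of a rule with left-hand side `A`. -/
def Calls (A B : N) : Prop :=
  (A = G.start ∧ Rule.start B ∈ G.rules) ∨
  (∃ ρ C, Rule.binary A ρ B C ∈ G.rules) ∨
  (∃ ρ C, Rule.binary A ρ C B ∈ G.rules) ∨
  Rule.unit A B ∈ G.rules

/-- Every nonterminal is reachable from the start symbol and productive. -/
def IsReduced : Prop :=
  ∀ A ∈ G.nonterms, Relation.ReflTransGen G.Calls G.start A ∧ ∃ u, G.Derives A u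

end Grammar

section Contexts

variable {α : Type*}

/-- `E`, a word over the terminals and the hole symbols `Sum.inr i`, is a sentence context of
arity `d`: the holes occurring in it are `0, …, d - 1`, each exactly once. -/
def IsContext (d : ℕ) (E : List (α ⊕ ℕ)) : Prop :=
  (E.filterMap Sum.getRight?).Perm (List.range d)

/-- The word `E[w]`. -/
def fill (E : List (α ⊕ ℕ)) (w : List (List α)) : List α :=
  E.flatMap (Sum.elim (fun a => [a]) (fun i => w.getD i []))

/-- The arity-`d` tuple distribution of `x` in `L`. -/
def tupleDist (L : Language α) (d : ℕ) (x : List (List α)) : Set (List (α ⊕ ℕ)) :=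
  {E | IsContext d E ∧ fill E x ∈ L}

variable {M : Type*} [Monoid M]

/-- The value `h(w)` at a word `w`. -/
def hWord (h : FreeMonoid α →* M) (w : List α) : M := h (FreeMonoid.ofList w)

/-- The componentwise `h`-type of a tuple. -/
def hType (h : FreeMonoid α →* M) (x : List (List α)) : List M := x.map (hWord h)

/-- `(f, h)`-tuple substitutability. -/
def TupleSubstitutable (f : ℕ) (h : FreeMonoid α →* M) (L : Language α) : Prop :=
  ∀ d, 1 ≤ d → d ≤ f → ∀ x y : List (List α), x.length = d → y.length = d →
    hType h x = hType h y → (tupleDist L d x ∩ tupleDist L d y).Nonempty →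
    tupleDist L d x = tupleDist L d y

/-- The class of `(f, h)`-tuple-substitutable languages that are generated by a reduced working
binary linear nondeleting MCFG of fan-out at most `f`. -/
def tupleClass (f : ℕ) (h : FreeMonoid α →* M) : Set (Language α) :=
  {L | (∃ (N : Type) (G : Grammar α N), G.IsWorking ∧ G.IsReduced ∧
          (∀ A ∈ G.nonterms, G.fanout A ≤ f) ∧ G.language = L) ∧
       TupleSubstitutable f h L}

end Contexts

section Interfaces

variable {α : Type*} {M : Type*} [Monoid M]

/-- An interface type `(σ; m₀, …, m_d)`: the permutation `σ` in one-line notation (the list of the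
names of the holes from left to right) and the list of the `d + 1` monoid elements. -/
abbrev Iface (M : Type*) := List ℕ × List M

/-- The products of the maximal (possibly empty) blocks of monoid elements between consecutive
variables of a decorated word. -/
def blockProducts : List (M ⊕ ℕ) → List M
  | [] => [1]
  | Sum.inl m :: w => (blockProducts w).modifyHead (fun n => m * n)
  | Sum.inr _ :: w => 1 :: blockProducts w

/-- The normal form of a decorated word `β₀ z₁ β₁ ⋯ z_d β_d`: the order `z₁, …, z_d` of the variables
and the products of the blocks `β₀, …, β_d`. -/
def normalForm (w : List (M ⊕ ℕ)) : Iface M :=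
  (w.filterMap Sum.getRight?, blockProducts w)

/-- The sentence-interface type of `E = u₀ □_{σ 1} u₁ ⋯ □_{σ d} u_d`, which is
`(σ; h u₀, h u₁, …, h u_d)`. -/
def ifaceType (h : FreeMonoid α →* M) (E : List (α ⊕ ℕ)) : Iface M :=
  normalForm (E.map (Sum.map (fun a => h (FreeMonoid.of a)) id))

/-- `m₀ α_{σ 1} m₁ ⋯ α_{σ e} m_e`, where the symbols of the template are decorated by `dec`. -/
def trace (dec : TSym α → M ⊕ ℕ) (ρ : Template α) : Iface M → List (M ⊕ ℕ)
  | (_, []) => []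
  | (σ, m :: ms) =>
      Sum.inl m :: (σ.zip ms).flatMap fun p => (ρ.getD p.1 []).map dec ++ [Sum.inl p.2]

/-- Decoration for the first child: `x`-variables stay visible. -/
def decB (h : FreeMonoid α →* M) (r : List M) : TSym α → M ⊕ ℕ
  | TSym.letter a => Sum.inl (h (FreeMonoid.of a))
  | TSym.x i => Sum.inr i
  | TSym.y j => Sum.inl (r.getD j 1)

/-- Decoration for the second child: `y`-variables stay visible. -/
def decC (h : FreeMonoid α →* M) (q : List M) : TSym α → M ⊕ ℕ
  | TSym.letter a => Sum.inl (h (FreeMonoid.of a))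
  | TSym.x i => Sum.inl (q.getD i 1)
  | TSym.y j => Sum.inr j

/-- Interface transport to the first child; `r` is the componentwise type of the second child. -/
def transportB (h : FreeMonoid α →* M) (ρ : Template α) (τ : Iface M) (r : List M) : Iface M :=
  normalForm (trace (decB h r) ρ τ)

/-- Interface transport to the second child; `q` is the componentwise type of the first child. -/
def transportC (h : FreeMonoid α →* M) (ρ : Template α) (τ : Iface M) (q : List M) : Iface M :=
  normalForm (trace (decC h q) ρ τ)

end Interfaces

/-- A typed tuple `[x : τ]`. -/
structure TypedTuple (α M : Type*) where
  tuple : List (List α)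
  iface : Iface M

/-- Nonterminals of the learner grammar: the fresh start symbol is `none`. -/
abbrev LearnerNT (α M : Type*) := Option (TypedTuple α M)

section Learner

variable {α : Type*} {M : Type*} [Monoid M]

/-- The typed tuple `t` is observed in the sample `K` through the context `E`. -/
def ObservedVia (f : ℕ) (h : FreeMonoid α →* M) (K : Set (List α)) (E : List (α ⊕ ℕ))
    (t : TypedTuple α M) : Prop :=
  1 ≤ t.tuple.length ∧ t.tuple.length ≤ f ∧ IsContext t.tuple.length E ∧
    fill E t.tuple ∈ K ∧ ifaceType h E = t.iface

/-- The typed tuple `t` is observed in the sample `K`. -/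
def Observed (f : ℕ) (h : FreeMonoid α →* M) (K : Set (List α)) (t : TypedTuple α M) : Prop :=
  ∃ E, ObservedVia f h K E t

/-- There is a typed binary witness in `K` with parent typed tuple `p`, child typed tuples `b` and
`c`, and template `ρ`.  A segmentation of the parent tuple into terminal gaps and labelled variable
intervals (with tie orders for empty intervals) is the same as a linear nondeleting template that
produces the parent tuple from the child tuples. -/
def TypedWitness (f : ℕ) (h : FreeMonoid α →* M) (K : Set (List α))
    (p : TypedTuple α M) (ρ : Template α) (b c : TypedTuple α M) : Prop :=
  Observed f h K p ∧ Observed f h K b ∧ Observed f h K c ∧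
    IsTemplate p.tuple.length b.tuple.length c.tuple.length ρ ∧
    applyTemplate ρ b.tuple c.tuple = p.tuple ∧
    transportB h ρ p.iface (hType h c.tuple) = b.iface ∧
    transportC h ρ p.iface (hType h b.tuple) = c.iface

/-- The rules of the learner grammar. -/
inductive LearnerRule (f : ℕ) (h : FreeMonoid α →* M) (K : Set (List α)) :
    Rule α (LearnerNT α M) → Prop
  | start {w : List α} : w ∈ K →
      ObservedVia f h K [Sum.inr 0] ⟨[w], ifaceType h [Sum.inr 0]⟩ →
      LearnerRule f h K (Rule.start (some ⟨[w], ifaceType h [Sum.inr 0]⟩))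
  | terminal {a : α} {τ : Iface M} : Observed f h K ⟨[[a]], τ⟩ →
      LearnerRule f h K (Rule.terminal (some ⟨[[a]], τ⟩) a)
  | binary {p b c : TypedTuple α M} {ρ : Template α} : TypedWitness f h K p ρ b c →
      LearnerRule f h K (Rule.binary (some p) ρ (some b) (some c))
  | subst {x y : List (List α)} {E : List (α ⊕ ℕ)} : x.length = y.length →
      hType h x = hType h y →
      ObservedVia f h K E ⟨x, ifaceType h E⟩ → ObservedVia f h K E ⟨y, ifaceType h E⟩ →
      LearnerRule f h K (Rule.unit (some ⟨x, ifaceType h E⟩) (some ⟨y, ifaceType h E⟩))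

/-- The learner grammar `Ĝ(K)` of a sample `K`. -/
def learnerGrammar (f : ℕ) (h : FreeMonoid α →* M) (K : Set (List α)) :
    Grammar α (LearnerNT α M) where
  nonterms := {A | A = none ∨ ∃ t, A = some t ∧ Observed f h K t}
  start := none
  fanout := fun A => match A with
    | none => 1
    | some t => t.tuple.length
  rules := {r | LearnerRule f h K r}

end Learner

section Coding

/-! Codings of symbols, rules and typed tuples as data, used only to speak about computability. -/

def tSymEquiv (α : Type*) : TSym α ≃ α ⊕ (ℕ ⊕ ℕ) where
  toFun s := match s with
    | TSym.letter a => Sum.inl a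
    | TSym.x i => Sum.inr (Sum.inl i)
    | TSym.y j => Sum.inr (Sum.inr j)
  invFun s := match s with
    | Sum.inl a => TSym.letter a
    | Sum.inr (Sum.inl i) => TSym.x i
    | Sum.inr (Sum.inr j) => TSym.y j
  left_inv s := by cases s <;> rfl
  right_inv s := by rcases s with _ | _ | _ <;> rfl

instance instPrimcodableTSym (α : Type*) [Primcodable α] : Primcodable (TSym α) :=
  Primcodable.ofEquiv _ (tSymEquiv α)

def ruleEquiv (α N : Type*) :
    Rule α N ≃ (N ⊕ (N × α)) ⊕ ((N × Template α × N × N) ⊕ (N × N)) where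
  toFun r := match r with
    | Rule.start A => Sum.inl (Sum.inl A)
    | Rule.terminal A a => Sum.inl (Sum.inr (A, a))
    | Rule.binary A ρ B C => Sum.inr (Sum.inl (A, ρ, B, C))
    | Rule.unit A B => Sum.inr (Sum.inr (A, B))
  invFun r := match r with
    | Sum.inl (Sum.inl A) => Rule.start A
    | Sum.inl (Sum.inr (A, a)) => Rule.terminal A a
    | Sum.inr (Sum.inl (A, ρ, B, C)) => Rule.binary A ρ B C
    | Sum.inr (Sum.inr (A, B)) => Rule.unit A B
  left_inv r := by cases r <;> rfl
  right_inv r := by rcases r with (_ | ⟨_, _⟩) | (⟨_, _, _, _⟩ | ⟨_, _⟩) <;> rfl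

instance instPrimcodableRule (α N : Type*) [Primcodable α] [Primcodable N] :
    Primcodable (Rule α N) :=
  Primcodable.ofEquiv _ (ruleEquiv α N)

def typedTupleEquiv (α M : Type*) : TypedTuple α M ≃ List (List α) × Iface M where
  toFun t := (t.tuple, t.iface)
  invFun p := ⟨p.1, p.2⟩
  left_inv _ := rfl
  right_inv _ := rfl

instance instPrimcodableTypedTuple (α M : Type*) [Primcodable α] [Primcodable M] :
    Primcodable (TypedTuple α M) :=
  Primcodable.ofEquiv _ (typedTupleEquiv α M)

/-- An explicit finite description of a grammar: its nonterminals with their fan-outs, its start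
symbol and its rules. -/
abbrev GrammarCode (α N : Type*) := List (N × ℕ) × N × List (Rule α N)

/-- The description `c` describes the grammar `G`. -/
def Describes {α N : Type*} (c : GrammarCode α N) (G : Grammar α N) : Prop :=
  (∀ A d, (A, d) ∈ c.1 ↔ A ∈ G.nonterms ∧ d = G.fanout A) ∧
    c.2.1 = G.start ∧ ∀ r, r ∈ c.2.2 ↔ r ∈ G.rules

end Coding

section Identification

variable {α N : Type*}

/-- A map from finite sequences of words to grammars is computable: an explicit finite description
of the hypothesis grammar is computable from the sequence. -/
def ComputableLearner [Primcodable α] [Primcodable N]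
    (𝒜 : List (List α) → Grammar α N) : Prop :=
  ∃ g : List (List α) → GrammarCode α N, Computable g ∧ ∀ p, Describes (g p) (𝒜 p)

/-- `w` is a text for `L`. -/
def IsText (w : ℕ → List α) (L : Language α) : Prop :=
  (∀ n, w n ∈ L) ∧ ∀ v ∈ L, ∃ n, w n = v

/-- `𝒜` identifies the class `𝒞` in the limit from positive data. -/
def IdentifiesInLimit [Primcodable α] [Primcodable N]
    (𝒜 : List (List α) → Grammar α N) (𝒞 : Set (Language α)) : Prop :=
  ComputableLearner 𝒜 ∧
    ∀ L ∈ 𝒞, ∀ w : ℕ → List α, IsText w L →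
      ∃ n₀, ∀ n ≥ n₀, (𝒜 ((List.range n).map w)).language = L

end Identification

end TupleLearning

/-!
The proof has a soundness half, a completeness half, and a computability part.

*Soundness.* If the sample `K` lies in a substitutable language `L`, then every tuple `u` derived
from `[x : τ]` in the learner grammar has the type and the distribution of `x`
(`derives_learnerGrammar_sound`).  For a substitution rule this is substitutability itself, as the
common context of the two tuples witnesses that their distributions meet.  For a binary rule, a
context `E` of `ρ(u, v)` turns into a context of `u` by plugging `ρ(·, v)` into its holes (`plug`,
`expandB`), and likewise into a context of `v`, so that `u` and `v` can be exchanged one at a time.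

*Completeness.* Let `G` generate `L`.  For each nonterminal `A` fix a representative of every type
`q` of tuples derivable from `A`, and a representative of every interface type `τ` of contexts that
take all tuples of `A` into `L`.  There are finitely many such data, so that finitely many words
of `L` suffice to observe all representatives, and all tuples that one rule of `G` builds from
representatives, in the representative contexts (`Grammar.exists_characteristic`).  Once these words
are in the sample, each `G`-derivation of `u` from `A` is simulated from
`[repTuple A (h u) : τ]`, for every `τ` that occurs at `A`
(`Grammar.Characteristic.simulates`): a substitution rule passes to the tuple built by the rule of
`G`, a binary rule to the representatives at its children.  The interface types fit because interface
transport computes the type of the plugged context (`ifaceType_plug_expandB`,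
`ifaceType_plug_expandC`): normal forms do not change when adjacent monoid
elements of a decorated word are multiplied, also if templates are plugged in afterwards
(`normalForm_trace`).

*Computability.* Contexts, tuples and templates that can occur have bounded length over a finite
set of symbols, so that nonterminals and rules are obtained by filtering finite lists with
primitive recursive conditions.  The closure properties of `PrimrecListable` organize this.
-/

namespace TupleLearning

/-! ### Plugging a template into a context -/

section Substitution

variable {α : Type*}

theorem filterMap_inl_cons {β : Type*} (b : β) (w : List (β ⊕ ℕ)) :
    (Sum.inl b :: w).filterMap Sum.getRight? = w.filterMap Sum.getRight? := rfl

/-- Plug the template `ρ` into the holes of the context `E`: hole `i` becomes the `i`-th word of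
`ρ`, in which every symbol is expanded by `g`. -/
def plug (E : List (α ⊕ ℕ)) (ρ : Template α) (g : TSym α → List (α ⊕ ℕ)) : List (α ⊕ ℕ) :=
  E.flatMap (Sum.elim (fun a => [Sum.inl a]) (fun i => (ρ.getD i []).flatMap g))

/-- Expansion for the first child: `x`-variables become holes, `y`-variables are filled by `v`. -/
def expandB (v : List (List α)) : TSym α → List (α ⊕ ℕ)
  | TSym.letter a => [Sum.inl a]
  | TSym.x i => [Sum.inr i]
  | TSym.y j => (v.getD j []).map Sum.inl

/-- Expansion for the second child: `y`-variables become holes, `x`-variables are filled by `u`. -/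
def expandC (u : List (List α)) : TSym α → List (α ⊕ ℕ)
  | TSym.letter a => [Sum.inl a]
  | TSym.x i => (u.getD i []).map Sum.inl
  | TSym.y j => [Sum.inr j]

theorem fill_map_inl (w : List α) (u : List (List α)) : fill (w.map Sum.inl) u = w := by
  induction w with
  | nil => rfl
  | cons a w ih => simpa [fill] using ih

theorem fill_plug {E : List (α ⊕ ℕ)} {ρ : Template α} {g : TSym α → List (α ⊕ ℕ)}
    {u v w : List (List α)}
    (hg : ∀ s, fill (g s) w = substWord u v [s]) :
    fill (plug E ρ g) w = fill E (applyTemplate ρ u v) := by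
  have key : ∀ l : List (TSym α), fill (l.flatMap g) w = substWord u v l := by
    intro l
    induction l with
    | nil => rfl
    | cons s l ih =>
      have h1 : fill ((s :: l).flatMap g) w = fill (g s) w ++ fill (l.flatMap g) w := by
        simp [fill]
      rw [h1, hg, ih]
      simp [substWord]
  have hget : ∀ i, (applyTemplate ρ u v).getD i [] = substWord u v (ρ.getD i []) := by
    intro i
    simp only [applyTemplate, List.getD_eq_getElem?_getD, List.getElem?_map]
    cases ρ[i]? <;> rfl
  induction E with
  | nil => rfl
  | cons s E ih =>
    have h1 : fill (plug (s :: E) ρ g) w = fill (plug [s] ρ g) w ++ fill (plug E ρ g) w := by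
      simp [fill, plug]
    have h2 : fill (s :: E) (applyTemplate ρ u v) =
        fill [s] (applyTemplate ρ u v) ++ fill E (applyTemplate ρ u v) := by
      simp [fill]
    rw [h1, h2, ih]
    congr 1
    cases s with
    | inl a => rfl
    | inr i =>
      simp only [plug, List.flatMap_cons, List.flatMap_nil, List.append_nil, Sum.elim_inr, key]
      simp only [fill, List.flatMap_cons, List.flatMap_nil, List.append_nil, Sum.elim_inr, hget]

theorem fill_plug_expandB (E : List (α ⊕ ℕ)) (ρ : Template α) (u v : List (List α)) :
    fill (plug E ρ (expandB v)) u = fill E (applyTemplate ρ u v) :=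
  fill_plug fun s => by
    cases s with
    | letter a => rfl
    | x i => rfl
    | y j => simp [expandB, fill_map_inl, substWord]

theorem fill_plug_expandC (E : List (α ⊕ ℕ)) (ρ : Template α) (u v : List (List α)) :
    fill (plug E ρ (expandC u)) v = fill E (applyTemplate ρ u v) :=
  fill_plug fun s => by
    cases s with
    | letter a => rfl
    | x i => simp [expandC, fill_map_inl, substWord]
    | y j => rfl

theorem isContext_plug {E : List (α ⊕ ℕ)} {ρ : Template α} {g : TSym α → List (α ⊕ ℕ)}
    {vars : List (TSym α) → List ℕ} {e d : ℕ}
    (hvars : ∀ l, (l.flatMap g).filterMap Sum.getRight? = vars l)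
    (hE : IsContext e E) (hlen : ρ.length = e) (hρ : (vars ρ.flatten).Perm (List.range d)) :
    IsContext d (plug E ρ g) := by
  have h1 : (plug E ρ g).filterMap Sum.getRight? =
      (E.filterMap Sum.getRight?).flatMap fun i => vars (ρ.getD i []) := by
    clear hE
    induction E with
    | nil => rfl
    | cons s E ih =>
      have h2 : plug (s :: E) ρ g = plug [s] ρ g ++ plug E ρ g := by simp [plug]
      rw [h2, List.filterMap_append, ih]
      cases s with
      | inl a => rfl
      | inr i => simp [plug, hvars]
  have h2 : vars ρ.flatten = (List.range e).flatMap fun i => vars (ρ.getD i []) := by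
    have h3 : ρ = (List.range e).map fun i => ρ.getD i [] := by
      subst hlen
      apply List.ext_getElem
      · simp
      · intro i h1 h2
        simp [h1]
    conv_lhs => rw [h3]
    rw [← hvars, ← List.flatMap_def, List.flatMap_assoc, List.filterMap_flatMap]
    simp only [hvars]
  unfold IsContext at hE ⊢
  rw [h1]
  rw [h2] at hρ
  exact (hE.flatMap_right _).trans hρ

theorem filterMap_flatMap_expandB (v : List (List α)) (l : List (TSym α)) :
    (l.flatMap (expandB v)).filterMap Sum.getRight? = xVars l := by
  have h : ∀ w : List α, (w.map (Sum.inl : α → α ⊕ ℕ)).filterMap Sum.getRight? = [] := by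
    intro w; simp
  induction l with
  | nil => rfl
  | cons s l ih =>
    rw [List.flatMap_cons, List.filterMap_append, ih]
    cases s with
    | letter a => rfl
    | x i => rfl
    | y j => rw [expandB, h]; rfl

theorem filterMap_flatMap_expandC (u : List (List α)) (l : List (TSym α)) :
    (l.flatMap (expandC u)).filterMap Sum.getRight? = yVars l := by
  have h : ∀ w : List α, (w.map (Sum.inl : α → α ⊕ ℕ)).filterMap Sum.getRight? = [] := by
    intro w; simp
  induction l with
  | nil => rfl
  | cons s l ih =>
    rw [List.flatMap_cons, List.filterMap_append, ih]
    cases s with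
    | letter a => rfl
    | x i => rw [expandC, h]; rfl
    | y j => rfl

theorem isContext_plug_expandB {E : List (α ⊕ ℕ)} {ρ : Template α} {e dB dC : ℕ}
    (hE : IsContext e E) (hρ : IsTemplate e dB dC ρ) (v : List (List α)) :
    IsContext dB (plug E ρ (expandB v)) :=
  isContext_plug (filterMap_flatMap_expandB v) hE hρ.1 hρ.2.1

theorem isContext_plug_expandC {E : List (α ⊕ ℕ)} {ρ : Template α} {e dB dC : ℕ}
    (hE : IsContext e E) (hρ : IsTemplate e dB dC ρ) (u : List (List α)) :
    IsContext dC (plug E ρ (expandC u)) :=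
  isContext_plug (filterMap_flatMap_expandC u) hE hρ.1 hρ.2.2

end Substitution

/-! ### Interface types of plugged contexts -/

section NormalForms

variable {α M : Type*} [Monoid M]

theorem normalForm_cons_congr {w w' : List (M ⊕ ℕ)} (s : M ⊕ ℕ)
    (hw : normalForm w = normalForm w') : normalForm (s :: w) = normalForm (s :: w') := by
  simp only [normalForm, Prod.mk.injEq] at hw ⊢
  cases s <;> simp [blockProducts, filterMap_inl_cons, hw.1, hw.2]

theorem normalForm_append_congr {w w' : List (M ⊕ ℕ)} (u : List (M ⊕ ℕ))
    (hw : normalForm w = normalForm w') : normalForm (u ++ w) = normalForm (u ++ w') := by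
  induction u with
  | nil => exact hw
  | cons s u ih => exact normalForm_cons_congr s ih

theorem blockProducts_eq_cons (w : List (M ⊕ ℕ)) : ∃ m ms, blockProducts w = m :: ms := by
  induction w with
  | nil => exact ⟨_, _, rfl⟩
  | cons s w ih =>
    obtain ⟨m, ms, hm⟩ := ih
    cases s <;> simp [blockProducts, hm]

theorem normalForm_mul_cons (m n : M) (w : List (M ⊕ ℕ)) :
    normalForm (Sum.inl (m * n) :: w) = normalForm (Sum.inl m :: Sum.inl n :: w) := by
  obtain ⟨k, ks, hk⟩ := blockProducts_eq_cons w
  simp [normalForm, blockProducts, filterMap_inl_cons, hk, mul_assoc]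

theorem normalForm_one_cons (w : List (M ⊕ ℕ)) :
    normalForm (Sum.inl 1 :: w) = normalForm w := by
  obtain ⟨k, ks, hk⟩ := blockProducts_eq_cons w
  simp [normalForm, blockProducts, filterMap_inl_cons, hk]

/-- The words `E` and `m₀ □ m₁ ⋯ □ m_d` read off from the normal form of `E` become equivalent
when the same template is plugged into their holes. -/
theorem normalForm_trace (dec : TSym α → M ⊕ ℕ) (ρ : Template α) (w : List (M ⊕ ℕ)) :
    normalForm (trace dec ρ (normalForm w)) =
      normalForm (w.flatMap
        (Sum.elim (fun m => [Sum.inl m]) (fun i => (ρ.getD i []).map dec))) := by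
  induction w with
  | nil => simp [normalForm, blockProducts, trace]
  | cons s w ih =>
    obtain ⟨k, ks, hk⟩ := blockProducts_eq_cons w
    have hw : normalForm w = (w.filterMap Sum.getRight?, k :: ks) := by rw [normalForm, hk]
    rw [hw] at ih
    cases s with
    | inl m =>
      have h1 : normalForm (Sum.inl m :: w) = (w.filterMap Sum.getRight?, (m * k) :: ks) := by
        simp [normalForm, blockProducts, filterMap_inl_cons, hk]
      rw [h1]
      refine (normalForm_mul_cons _ _ _).trans ?_
      simpa [trace] using normalForm_cons_congr (Sum.inl m) ih
    | inr i =>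
      have h1 : normalForm (Sum.inr i :: w) =
          (i :: w.filterMap Sum.getRight?, 1 :: k :: ks) := by
        simp [normalForm, blockProducts, hk]
      rw [h1]
      refine (normalForm_one_cons _).trans ?_
      simpa [trace] using normalForm_append_congr ((ρ.getD i []).map dec) ih

theorem hWord_cons (h : FreeMonoid α →* M) (a : α) (w : List α) :
    hWord h (a :: w) = h (FreeMonoid.of a) * hWord h w := by
  simp [hWord, FreeMonoid.ofList_cons]

theorem hWord_nil (h : FreeMonoid α →* M) : hWord h [] = 1 := map_one h

theorem hWord_append (h : FreeMonoid α →* M) (v w : List α) :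
    hWord h (v ++ w) = hWord h v * hWord h w := by
  simp [hWord, FreeMonoid.ofList_append]

theorem hType_getD (h : FreeMonoid α →* M) (v : List (List α)) (j : ℕ) :
    (hType h v).getD j 1 = hWord h (v.getD j []) := by
  simp only [hType, List.getD_eq_getElem?_getD, List.getElem?_map]
  cases v[j]? <;> simp [hWord_nil]

/-- The letterwise image of a context in the decorated words over `M`. -/
def decorate (h : FreeMonoid α →* M) (E : List (α ⊕ ℕ)) : List (M ⊕ ℕ) :=
  E.map (Sum.map (fun a => h (FreeMonoid.of a)) id)

theorem decorate_append (h : FreeMonoid α →* M) (E F : List (α ⊕ ℕ)) :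
    decorate h (E ++ F) = decorate h E ++ decorate h F := List.map_append

/-- A block of letters may be replaced by its value in `M` without changing the normal form. -/
theorem normalForm_decorate_map_inl (h : FreeMonoid α →* M) (v : List α) (w : List (M ⊕ ℕ)) :
    normalForm (decorate h (v.map Sum.inl) ++ w) = normalForm (Sum.inl (hWord h v) :: w) := by
  induction v with
  | nil => simpa [decorate, hWord_nil] using (normalForm_one_cons w).symm
  | cons a v ih =>
    rw [hWord_cons, normalForm_mul_cons, ← normalForm_cons_congr _ ih]
    rfl

/-- Transport of interface types, for an expansion `g` of the template symbols that agrees with the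
decoration `dec` up to multiplying out blocks. -/
theorem ifaceType_plug (h : FreeMonoid α →* M) {dec : TSym α → M ⊕ ℕ}
    {g : TSym α → List (α ⊕ ℕ)}
    (hg : ∀ s w, normalForm (decorate h (g s) ++ w) = normalForm (dec s :: w))
    (E : List (α ⊕ ℕ)) (ρ : Template α) :
    ifaceType h (plug E ρ g) = normalForm (trace dec ρ (ifaceType h E)) := by
  have key : ∀ (l : List (TSym α)) (w : List (M ⊕ ℕ)),
      normalForm (decorate h (l.flatMap g) ++ w) = normalForm (l.map dec ++ w) := by
    intro l w
    induction l with
    | nil => rfl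
    | cons s l ih =>
      rw [List.flatMap_cons, decorate_append, List.append_assoc, hg]
      exact normalForm_cons_congr _ ih
  refine Eq.trans ?_ (normalForm_trace dec ρ (decorate h E)).symm
  change normalForm (decorate h (plug E ρ g)) = _
  induction E with
  | nil => rfl
  | cons s E ih =>
    cases s with
    | inl a => exact normalForm_cons_congr _ ih
    | inr i =>
      have h1 : plug (Sum.inr i :: E) ρ g = (ρ.getD i []).flatMap g ++ plug E ρ g := rfl
      rw [h1, decorate_append, key]
      exact normalForm_append_congr _ ih

theorem ifaceType_plug_expandB (h : FreeMonoid α →* M) (E : List (α ⊕ ℕ)) (ρ : Template α)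
    (v : List (List α)) :
    ifaceType h (plug E ρ (expandB v)) = transportB h ρ (ifaceType h E) (hType h v) :=
  ifaceType_plug h (fun s w => by
    cases s with
    | letter a => rfl
    | x i => rfl
    | y j => rw [decB, hType_getD]; exact normalForm_decorate_map_inl h _ w) E ρ

theorem ifaceType_plug_expandC (h : FreeMonoid α →* M) (E : List (α ⊕ ℕ)) (ρ : Template α)
    (u : List (List α)) :
    ifaceType h (plug E ρ (expandC u)) = transportC h ρ (ifaceType h E) (hType h u) :=
  ifaceType_plug h (fun s w => by
    cases s with
    | letter a => rfl
    | x i => rw [decC, hType_getD]; exact normalForm_decorate_map_inl h _ w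
    | y j => rfl) E ρ

/-- The type of `ρ(u, v)` depends only on the types of `u` and `v`. -/
theorem hType_applyTemplate_congr (h : FreeMonoid α →* M) (ρ : Template α)
    {u u' v v' : List (List α)} (hu : hType h u = hType h u') (hv : hType h v = hType h v') :
    hType h (applyTemplate ρ u v) = hType h (applyTemplate ρ u' v') := by
  simp only [hType, applyTemplate, List.map_map]
  refine List.map_congr_left fun l hl => ?_
  clear hl
  simp only [Function.comp]
  induction l with
  | nil => rfl
  | cons s l ih =>
    have hs : ∀ u v, substWord u v (s :: l) = substWord u v [s] ++ substWord u v l := by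
      intro u v; simp [substWord]
    rw [hs, hs, hWord_append, hWord_append, ih]
    congr 1
    cases s with
    | letter a => rfl
    | x i => simp only [substWord, List.flatMap_cons, List.flatMap_nil, List.append_nil,
        ← hType_getD, hu]
    | y j => simp only [substWord, List.flatMap_cons, List.flatMap_nil, List.append_nil,
        ← hType_getD, hv]

theorem blockProducts_length (w : List (M ⊕ ℕ)) :
    (blockProducts w).length = (w.filterMap Sum.getRight?).length + 1 := by
  induction w with
  | nil => rfl
  | cons s w ih =>
    cases s with
    | inl m => simpa [blockProducts, filterMap_inl_cons] using ih
    | inr i => simp [blockProducts, ih]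

/-- A context of arity `d ≤ f` has an interface type among finitely many. -/
theorem finite_ifaceTypes [Finite M] (f : ℕ) (h : FreeMonoid α →* M) :
    {τ | ∃ d ≤ f, ∃ E, IsContext d E ∧ ifaceType h E = τ}.Finite := by
  have h1 : {σ : List ℕ | ∃ d ≤ f, σ.Perm (List.range d)}.Finite := by
    refine ((Set.finite_Iic f).biUnion fun d _ => List.finite_toSet
      (List.permutations (List.range d))).subset ?_
    rintro σ ⟨d, hd, hσ⟩
    simpa using ⟨d, hd, hσ⟩
  refine (h1.prod (List.finite_length_le M (f + 1))).subset ?_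
  rintro τ ⟨d, hd, E, hE, rfl⟩
  have h2 : (ifaceType h E).1 = E.filterMap Sum.getRight? := by
    simp only [ifaceType, normalForm, List.filterMap_map]
    congr 1
    funext s
    cases s <;> rfl
  refine ⟨⟨d, hd, h2 ▸ hE⟩, ?_⟩
  have h3 : (ifaceType h E).2.length = (ifaceType h E).1.length + 1 := blockProducts_length _
  have h4 : (E.filterMap Sum.getRight?).length = d := by simpa using hE.length_eq
  simp only [Set.mem_ofPred_eq]
  rw [h3, h2, h4]
  omega

end NormalForms

/-! ### Soundness of the learner grammar -/

section Soundness

variable {α M : Type*} [Monoid M]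

theorem mem_tupleDist {L : Language α} {d : ℕ} {x : List (List α)} {E : List (α ⊕ ℕ)} :
    E ∈ tupleDist L d x ↔ IsContext d E ∧ fill E x ∈ L := Iff.rfl

/-- Distributional equivalence is a congruence for templates. -/
theorem tupleDist_applyTemplate_congr {L : Language α} {e dB dC : ℕ} {ρ : Template α}
    (hρ : IsTemplate e dB dC ρ) {x y u v : List (List α)}
    (hx : tupleDist L dB x = tupleDist L dB u) (hy : tupleDist L dC y = tupleDist L dC v) :
    tupleDist L e (applyTemplate ρ x y) = tupleDist L e (applyTemplate ρ u v) := by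
  ext E
  simp only [mem_tupleDist]
  refine and_congr_right fun hE => ?_
  have h1 : fill E (applyTemplate ρ x y) ∈ L ↔ fill E (applyTemplate ρ u y) ∈ L := by
    have h2 := Set.ext_iff.1 hx (plug E ρ (expandB y))
    simpa [mem_tupleDist, isContext_plug_expandB hE hρ, fill_plug_expandB] using h2
  have h3 : fill E (applyTemplate ρ u y) ∈ L ↔ fill E (applyTemplate ρ u v) ∈ L := by
    have h2 := Set.ext_iff.1 hy (plug E ρ (expandC u))
    simpa [mem_tupleDist, isContext_plug_expandC hE hρ, fill_plug_expandC] using h2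
  exact h1.trans h3

theorem isContext_hole : IsContext 1 ([Sum.inr 0] : List (α ⊕ ℕ)) := List.Perm.refl _

theorem fill_hole (w : List α) : fill [Sum.inr 0] [w] = w := by simp [fill]

/-- Every tuple derived from `[x : τ]` in the learner grammar of a sample of `L` has the type and
the distribution of `x`; the interface types play no role in this direction. -/
theorem derives_learnerGrammar_sound {f : ℕ} {h : FreeMonoid α →* M} {K : Set (List α)}
    {L : Language α} (hL : TupleSubstitutable f h L) (hK : ∀ w ∈ K, w ∈ L)
    {A : LearnerNT α M} {u : List (List α)} (hd : (learnerGrammar f h K).Derives A u) :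
    (∀ t, A = some t → t.tuple.length = u.length ∧ hType h t.tuple = hType h u ∧
      tupleDist L t.tuple.length t.tuple = tupleDist L t.tuple.length u) ∧
    (A = none → ∀ w, u = [w] → w ∈ L) := by
  induction hd with
  | start hr _ ih =>
    refine ⟨fun t ht => (nomatch ht), fun _ w hw => ?_⟩
    subst hw
    cases hr with
    | @start w₀ hw₀ _ =>
      have h1 : [Sum.inr 0] ∈ tupleDist L 1 [w₀] :=
        mem_tupleDist.2 ⟨isContext_hole, by rw [fill_hole]; exact hK _ hw₀⟩
      have h2 := (ih.1 _ rfl).2.2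
      simp only [List.length_singleton] at h2
      rw [h2] at h1
      simpa [fill_hole] using h1.2
  | terminal hr =>
    cases hr with
    | terminal _ =>
      refine ⟨fun t ht => ?_, fun h => nomatch h⟩
      cases ht
      exact ⟨rfl, rfl, rfl⟩
  | binary hr _ _ ihB ihC =>
    cases hr with
    | binary hw =>
      obtain ⟨-, -, -, hρ, hp, -, -⟩ := hw
      obtain ⟨-, hB2, hB3⟩ := ihB.1 _ rfl
      obtain ⟨-, hC2, hC3⟩ := ihC.1 _ rfl
      refine ⟨fun t ht => ?_, fun h => nomatch h⟩
      cases ht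
      refine ⟨by simp [applyTemplate, hρ.1], ?_, ?_⟩
      · rw [← hp]
        exact hType_applyTemplate_congr h _ hB2 hC2
      · conv_lhs => arg 3; rw [← hp]
        exact tupleDist_applyTemplate_congr hρ hB3 hC3
  | unit hr _ ih =>
    cases hr with
    | @subst x y E hlen hxy hx hy =>
      refine ⟨fun t ht => ?_, fun h => nomatch h⟩
      cases ht
      obtain ⟨h1, h2, h3⟩ := ih.1 _ rfl
      simp only at h1 h2 h3 ⊢
      refine ⟨hlen.trans h1, hxy.trans h2, ?_⟩
      refine Eq.trans ?_ (hlen ▸ h3)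
      exact hL _ hx.1 hx.2.1 x y rfl hlen.symm hxy
        ⟨E, ⟨hx.2.2.1, hK _ hx.2.2.2.1⟩, ⟨hx.2.2.1, hK _ hy.2.2.2.1⟩⟩

theorem language_learnerGrammar_le {f : ℕ} {h : FreeMonoid α →* M} {K : Set (List α)}
    {L : Language α} (hL : TupleSubstitutable f h L) (hK : ∀ w ∈ K, w ∈ L) :
    ∀ w ∈ (learnerGrammar f h K).language, w ∈ L := fun w hw =>
  (derives_learnerGrammar_sound hL hK hw).2 rfl w rfl

end Soundness

/-! ### Simulation of the target grammar on characteristic samples -/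

section Completeness

variable {α M N : Type*} [Monoid M]

/-- `E` is a context of the nonterminal `A`: it takes all tuples derived from `A` into `L(G)`. -/
def Grammar.Accepts (G : Grammar α N) (A : N) (E : List (α ⊕ ℕ)) : Prop :=
  IsContext (G.fanout A) E ∧ ∀ u, G.Derives A u → fill E u ∈ G.language

namespace Grammar

variable {G : Grammar α N}

theorem derives_length (hG : G.IsWorking) {A : N} {u : List (List α)} (hd : G.Derives A u) :
    u.length = G.fanout A := by
  induction hd with
  | start hr _ ih =>
    have := hG.working_rules _ hr
    rw [ih, this.2.2, hG.fanout_start]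
  | terminal hr => exact (hG.working_rules _ hr).2.2.symm
  | binary hr _ _ _ _ =>
    obtain ⟨-, -, -, -, -, -, hρ⟩ := hG.working_rules _ hr
    simpa [applyTemplate] using hρ.1
  | unit hr _ _ => exact (hG.working_rules _ hr).elim

theorem Derives.mem_nonterms (hG : G.IsWorking) {A : N} {u : List (List α)}
    (hd : G.Derives A u) : A ∈ G.nonterms := by
  cases hd with
  | start hr _ => exact hG.start_mem
  | terminal hr => exact (hG.working_rules _ hr).1
  | binary hr _ _ => exact (hG.working_rules _ hr).1
  | unit hr _ => exact (hG.working_rules _ hr).elim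

theorem accepts_hole {A : N} (hG : G.IsWorking) (hr : Rule.start A ∈ G.rules) :
    G.Accepts A [Sum.inr 0] := by
  have hA := (hG.working_rules _ hr).2.2
  refine ⟨hA ▸ isContext_hole, fun u hu => ?_⟩
  obtain ⟨w, rfl⟩ := List.length_eq_one_iff.1 ((derives_length hG hu).trans hA)
  rw [fill_hole]
  exact Derives.start hr hu

theorem Accepts.expandB {A B C : N} {ρ : Template α} {E : List (α ⊕ ℕ)} {v : List (List α)}
    (hE : G.Accepts A E) (hG : G.IsWorking) (hr : Rule.binary A ρ B C ∈ G.rules)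
    (hv : G.Derives C v) : G.Accepts B (plug E ρ (expandB v)) := by
  obtain ⟨-, -, -, -, -, -, hρ⟩ := hG.working_rules _ hr
  refine ⟨isContext_plug_expandB hE.1 hρ v, fun u hu => ?_⟩
  rw [fill_plug_expandB]
  exact hE.2 _ (Derives.binary hr hu hv)

theorem Accepts.expandC {A B C : N} {ρ : Template α} {E : List (α ⊕ ℕ)} {u : List (List α)}
    (hE : G.Accepts A E) (hG : G.IsWorking) (hr : Rule.binary A ρ B C ∈ G.rules)
    (hu : G.Derives B u) : G.Accepts C (plug E ρ (expandC u)) := by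
  obtain ⟨-, -, -, -, -, -, hρ⟩ := hG.working_rules _ hr
  refine ⟨isContext_plug_expandC hE.1 hρ u, fun v hv => ?_⟩
  rw [fill_plug_expandC]
  exact hE.2 _ (Derives.binary hr hu hv)

open Classical in
/-- A representative of the tuples of type `q` derivable from `A`; the empty tuple if there are
none. -/
noncomputable def repTuple (G : Grammar α N) (h : FreeMonoid α →* M) (A : N) (q : List M) :
    List (List α) :=
  if H : ∃ u, G.Derives A u ∧ hType h u = q then H.choose else []

open Classical in
/-- A representative of the contexts of `A` of interface type `τ`; the empty word if there are
none. -/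
noncomputable def repContext (G : Grammar α N) (h : FreeMonoid α →* M) (A : N) (τ : Iface M) :
    List (α ⊕ ℕ) :=
  if H : ∃ E, G.Accepts A E ∧ ifaceType h E = τ then H.choose else []

theorem repTuple_spec (h : FreeMonoid α →* M) {A : N} {u : List (List α)} (hu : G.Derives A u) :
    G.Derives A (G.repTuple h A (hType h u)) ∧
      hType h (G.repTuple h A (hType h u)) = hType h u := by
  have H : ∃ u', G.Derives A u' ∧ hType h u' = hType h u := ⟨u, hu, rfl⟩
  rw [repTuple, dif_pos H]
  exact H.choose_spec

theorem repContext_spec (h : FreeMonoid α →* M) {A : N} {E : List (α ⊕ ℕ)}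
    (hE : G.Accepts A E) :
    G.Accepts A (G.repContext h A (ifaceType h E)) ∧
      ifaceType h (G.repContext h A (ifaceType h E)) = ifaceType h E := by
  have H : ∃ E', G.Accepts A E' ∧ ifaceType h E' = ifaceType h E := ⟨E, hE, rfl⟩
  rw [repContext, dif_pos H]
  exact H.choose_spec

/-- A characteristic sample contains, for each nonterminal, type and interface type that occur, the
representative tuple in the representative context; for each rule the tuple that it builds from
representatives, in the representative contexts; and the representative words of the start rules. -/
structure Characteristic (G : Grammar α N) (h : FreeMonoid α →* M) (K : Set (List α)) : Prop where
  rep : ∀ A u E, G.Derives A u → G.Accepts A E →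
    fill (G.repContext h A (ifaceType h E)) (G.repTuple h A (hType h u)) ∈ K
  binary : ∀ A ρ B C u v E, Rule.binary A ρ B C ∈ G.rules → G.Derives B u → G.Derives C v →
    G.Accepts A E → fill (G.repContext h A (ifaceType h E))
      (applyTemplate ρ (G.repTuple h B (hType h u)) (G.repTuple h C (hType h v))) ∈ K
  terminal : ∀ A a E, Rule.terminal A a ∈ G.rules → G.Accepts A E →
    fill (G.repContext h A (ifaceType h E)) [[a]] ∈ K
  start : ∀ A u, Rule.start A ∈ G.rules → G.Derives A u →
    fill [Sum.inr 0] (G.repTuple h A (hType h u)) ∈ K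

variable {f : ℕ} {h : FreeMonoid α →* M} {K : Set (List α)}

theorem observedVia_repContext (hG : G.IsWorking) (hf : ∀ A ∈ G.nonterms, G.fanout A ≤ f)
    {A : N} {u : List (List α)} {E : List (α ⊕ ℕ)} (hu : G.Derives A u) (hE : G.Accepts A E)
    (hK : fill (G.repContext h A (ifaceType h E)) u ∈ K) :
    ObservedVia f h K (G.repContext h A (ifaceType h E)) ⟨u, ifaceType h E⟩ := by
  have hA := hu.mem_nonterms hG
  have hl := derives_length hG hu
  refine ⟨?_, ?_, ?_, hK, (repContext_spec h hE).2⟩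
  · exact hl ▸ hG.fanout_pos A hA
  · exact hl ▸ hf A hA
  · exact hl ▸ (repContext_spec h hE).1.1

/-- The substitution rule from the representative of the type of `u` to `u` itself. -/
theorem Characteristic.derives_of_derives (hK : G.Characteristic h K) (hG : G.IsWorking)
    (hf : ∀ A ∈ G.nonterms, G.fanout A ≤ f) {A : N} {u u' w : List (List α)} {E : List (α ⊕ ℕ)}
    (hu : G.Derives A u) (hE : G.Accepts A E) (huu' : hType h u' = hType h u)
    (hu' : fill (G.repContext h A (ifaceType h E)) u ∈ K)
    (hw : (learnerGrammar f h K).Derives (some ⟨u, ifaceType h E⟩) w) :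
    (learnerGrammar f h K).Derives
      (some ⟨G.repTuple h A (hType h u'), ifaceType h E⟩) w := by
  rw [huu']
  refine Derives.unit ?_ hw
  obtain ⟨h1, h2⟩ := repTuple_spec h hu
  -- `h5` puts the interface type in the form in which the rule mentions its observing context.
  have h3 := observedVia_repContext hG hf h1 hE (hK.rep _ _ _ hu hE)
  have h4 := observedVia_repContext hG hf hu hE hu'
  have h5 := (repContext_spec h hE).2
  generalize G.repContext h A (ifaceType h E) = F at h3 h4 h5
  rw [← h5] at h3 h4 ⊢
  exact LearnerRule.subst ((derives_length hG h1).trans (derives_length hG hu).symm) h2 h3 h4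

/-- Derivations of the target grammar are simulated by the learner grammar, in every interface type
that occurs at the nonterminal. -/
theorem Characteristic.simulates (hK : G.Characteristic h K) (hG : G.IsWorking)
    (hf : ∀ A ∈ G.nonterms, G.fanout A ≤ f) {A : N} {u : List (List α)} (hd : G.Derives A u) :
    A ≠ G.start → ∀ E, G.Accepts A E → (learnerGrammar f h K).Derives
      (some ⟨G.repTuple h A (hType h u), ifaceType h E⟩) u := by
  induction hd with
  | start hr _ _ => exact fun hA => (hA rfl).elim
  | @terminal A a hr =>
    intro _ E hE
    have ha := hK.terminal _ _ _ hr hE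
    refine hK.derives_of_derives hG hf (.terminal hr) hE rfl ha (.terminal ?_)
    exact LearnerRule.terminal ⟨_, observedVia_repContext hG hf (.terminal hr) hE ha⟩
  | @binary A B C ρ u v hr hu hv ihB ihC =>
    intro _ E hE
    obtain ⟨-, -, -, -, hB, hC, hρ⟩ := hG.working_rules _ hr
    obtain ⟨hu1, hu2⟩ := repTuple_spec h hu
    obtain ⟨hv1, hv2⟩ := repTuple_spec h hv
    have hEB := hE.expandB hG hr hv1
    have hEC := hE.expandC hG hr hu1
    have hz := hK.binary _ _ _ _ _ _ _ hr hu hv hE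
    have hd := Derives.binary hr hu1 hv1
    refine hK.derives_of_derives hG hf hd hE
      (hType_applyTemplate_congr h ρ hu2.symm hv2.symm) hz ?_
    refine Derives.binary ?_ (ihB hB _ hEB) (ihC hC _ hEC)
    refine LearnerRule.binary ⟨⟨_, observedVia_repContext hG hf hd hE hz⟩,
      ⟨_, observedVia_repContext hG hf hu1 hEB (hK.rep _ _ _ hu hEB)⟩,
      ⟨_, observedVia_repContext hG hf hv1 hEC (hK.rep _ _ _ hv hEC)⟩, ?_, rfl,
      (ifaceType_plug_expandB h E ρ _).symm, (ifaceType_plug_expandC h E ρ _).symm⟩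
    simp only
    rw [derives_length hG hd, derives_length hG hu1, derives_length hG hv1]
    exact hρ
  | unit hr _ _ => exact (hG.working_rules _ hr).elim

theorem Characteristic.language_le (hK : G.Characteristic h K) (hG : G.IsWorking)
    (hf : ∀ A ∈ G.nonterms, G.fanout A ≤ f) :
    ∀ w ∈ G.language, w ∈ (learnerGrammar f h K).language := by
  intro w hw
  generalize hu : [w] = u at *
  have hw' : G.Derives G.start u := hu ▸ hw
  clear hw
  generalize hS : G.start = S at *
  cases hw' with
  | @start A _ hr hd =>
    obtain ⟨-, hA, hA1⟩ := hG.working_rules _ hr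
    have hsim := hK.simulates hG hf hd hA _ (accepts_hole hG hr)
    obtain ⟨hx, -⟩ := repTuple_spec h hd
    have hxK := hK.start _ _ hr hd
    obtain ⟨x, hx'⟩ := List.length_eq_one_iff.1 ((derives_length hG hx).trans hA1)
    rw [hx'] at hsim hxK
    rw [fill_hole] at hxK
    subst hu
    refine Derives.start (G := learnerGrammar f h K) (LearnerRule.start hxK ?_) hsim
    refine ⟨le_rfl, ?_, isContext_hole, by rwa [fill_hole], rfl⟩
    have := hf A (hd.mem_nonterms hG)
    rwa [hA1] at this
  | terminal hr => exact ((hG.working_rules _ hr).2.1 hS.symm).elim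
  | binary hr _ _ => exact ((hG.working_rules _ hr).2.2.2.1 hS.symm).elim
  | unit hr _ => exact (hG.working_rules _ hr).elim

/-- Characteristic samples exist: there are only finitely many nonterminals, rules, types and
interface types. -/
theorem exists_characteristic [Finite M] (hG : G.IsWorking)
    (hf : ∀ A ∈ G.nonterms, G.fanout A ≤ f) (h : FreeMonoid α →* M) :
    ∃ S : Set (List α), S.Finite ∧ (∀ w ∈ S, w ∈ G.language) ∧
      ∀ K, S ⊆ K → G.Characteristic h K := by
  set T := {τ | ∃ d ≤ f, ∃ E : List (α ⊕ ℕ), IsContext d E ∧ ifaceType h E = τ} with hT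
  set Q := {q : List M | q.length ≤ f} with hQ
  have hTfin : T.Finite := finite_ifaceTypes f h
  have hQfin : Q.Finite := List.finite_length_le M f
  set S₁ := (fun p : N × List M × Iface M =>
    fill (G.repContext h p.1 p.2.2) (G.repTuple h p.1 p.2.1)) '' (G.nonterms ×ˢ Q ×ˢ T) with hS₁
  -- Words of start rules involve no interface type; `([], [])` is their dummy index.
  set S₂ := (fun p : Rule α N × List M × List M × Iface M => match p.1 with
    | Rule.binary A ρ B C => fill (G.repContext h A p.2.2.2)
        (applyTemplate ρ (G.repTuple h B p.2.1) (G.repTuple h C p.2.2.1))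
    | Rule.terminal A a => fill (G.repContext h A p.2.2.2) [[a]]
    | Rule.start A => fill [Sum.inr 0] (G.repTuple h A p.2.1)
    | Rule.unit _ _ => []) '' (G.rules ×ˢ Q ×ˢ Q ×ˢ insert ([], []) T) with hS₂
  have hfin : (S₁ ∪ S₂).Finite :=
    ((hG.finite_nonterms.prod (hQfin.prod hTfin)).image _).union
      ((hG.finite_rules.prod (hQfin.prod (hQfin.prod (hTfin.insert _)))).image _)
  have hq : ∀ {A u}, G.Derives A u → hType h u ∈ Q := fun {A u} hu => by
    rw [hQ, Set.mem_ofPred_eq, hType, List.length_map, derives_length hG hu]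
    exact hf A (hu.mem_nonterms hG)
  have hτ : ∀ {A E}, A ∈ G.nonterms → G.Accepts A E → ifaceType h E ∈ T := fun {A E} hA hE =>
    ⟨_, hf A hA, E, hE.1, rfl⟩
  -- `S₁` and `S₂` also contain words from default representatives, which may lie outside `L(G)`.
  refine ⟨{w ∈ S₁ ∪ S₂ | w ∈ G.language}, hfin.subset (Set.sep_subset _ _), fun w hw => hw.2,
    fun K hK => ⟨?_, ?_, ?_, ?_⟩⟩
  · intro A u E hu hE
    refine hK ⟨Or.inl ⟨(A, hType h u, ifaceType h E), ⟨?_, hq hu, ?_⟩, rfl⟩, ?_⟩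
    · exact hu.mem_nonterms hG
    · exact hτ (hu.mem_nonterms hG) hE
    · exact (repContext_spec h hE).1.2 _ (repTuple_spec h hu).1
  · intro A ρ B C u v E hr hu hv hE
    refine hK ⟨Or.inr ⟨(Rule.binary A ρ B C, hType h u, hType h v, ifaceType h E),
      ⟨hr, hq hu, hq hv, Or.inr ?_⟩, rfl⟩, ?_⟩
    · exact hτ (hG.working_rules _ hr).1 hE
    · exact (repContext_spec h hE).1.2 _
        (.binary hr (repTuple_spec h hu).1 (repTuple_spec h hv).1)
  · intro A a E hr hE
    refine hK ⟨Or.inr ⟨(Rule.terminal A a, [], [], ifaceType h E),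
      ⟨hr, ?_, ?_, Or.inr ?_⟩, rfl⟩, ?_⟩
    · exact Nat.zero_le f
    · exact Nat.zero_le f
    · exact hτ (hG.working_rules _ hr).1 hE
    · exact (repContext_spec h hE).1.2 _ (.terminal hr)
  · intro A u hr hu
    refine hK ⟨Or.inr ⟨(Rule.start A, hType h u, [], ([], [])),
      ⟨hr, hq hu, ?_, Or.inl rfl⟩, rfl⟩, ?_⟩
    · exact Nat.zero_le f
    · exact (accepts_hole hG hr).2 _ (repTuple_spec h hu).1

end Grammar

/-- Convergence on every text: from some point on the sample lies in `L` and contains a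
characteristic sample. -/
theorem exists_language_learnerGrammar_eq [Finite M] {f : ℕ} {h : FreeMonoid α →* M}
    {L : Language α} (hL : L ∈ tupleClass f h) {w : ℕ → List α} (hw : IsText w L) :
    ∃ n₀, ∀ n ≥ n₀, (learnerGrammar f h {v | v ∈ (List.range n).map w}).language = L := by
  obtain ⟨⟨N, G, hG, -, hf, rfl⟩, hsub⟩ := hL
  obtain ⟨S, hS, hSL, hchar⟩ := Grammar.exists_characteristic hG hf h
  have hidx : ∀ v ∈ S, ∃ n, w n = v := fun v hv => hw.2 v (hSL v hv)
  choose! idx hidx using hidx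
  obtain ⟨n₀, hn₀⟩ := (hS.image idx).bddAbove
  refine ⟨n₀ + 1, fun n hn => ?_⟩
  have hK : ∀ v ∈ {v | v ∈ (List.range n).map w}, v ∈ G.language := by
    intro v hv
    obtain ⟨i, -, rfl⟩ := List.mem_map.1 hv
    exact hw.1 i
  have hSK : S ⊆ {v | v ∈ (List.range n).map w} := by
    intro v hv
    have := hn₀ (Set.mem_image_of_mem idx hv)
    exact List.mem_map.2 ⟨idx v, List.mem_range.2 (by omega), hidx v hv⟩
  exact Set.Subset.antisymm (language_learnerGrammar_le hsub hK)
    ((hchar _ hSK).language_le hG hf)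

end Completeness

/-! ### Primitive recursive families of finite sets -/

section Listable

/-- The words of length at most `n` over the letters in `S`. -/
def wordsUpTo {β : Type*} (S : List β) (n : ℕ) : List (List β) :=
  Nat.rec [[]] (fun _ L => [] :: S.flatMap fun b => L.map fun l => b :: l) n

theorem mem_wordsUpTo {β : Type*} {S : List β} {n : ℕ} {l : List β} :
    l ∈ wordsUpTo S n ↔ l.length ≤ n ∧ ∀ b ∈ l, b ∈ S := by
  induction n generalizing l with
  | zero => cases l <;> simp [wordsUpTo]
  | succ n ih =>
    have h1 : wordsUpTo S (n + 1) =
        [] :: S.flatMap fun b => (wordsUpTo S n).map fun l => b :: l := rfl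
    cases l with
    | nil => simp [h1]
    | cons b l =>
      simp [h1, ih]
      tauto

variable {π β γ : Type*} [Primcodable π] [Primcodable β] [Primcodable γ]

/-- The sets `s p` are finite, and a primitive recursive function lists their elements. -/
def PrimrecListable (s : π → Set β) : Prop :=
  ∃ g : π → List β, Primrec g ∧ ∀ p b, b ∈ g p ↔ b ∈ s p

namespace PrimrecListable

variable {s : π → Set β} {t : π → Set γ}

theorem of_eq {s' : π → Set β} (hs : PrimrecListable s) (H : ∀ p b, b ∈ s p ↔ b ∈ s' p) :
    PrimrecListable s' := by
  obtain ⟨g, hg, hgs⟩ := hs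
  exact ⟨g, hg, fun p b => (hgs p b).trans (H p b)⟩

theorem list {g : π → List β} (hg : Primrec g) : PrimrecListable fun p => {b | b ∈ g p} :=
  ⟨g, hg, fun _ _ => Iff.rfl⟩

theorem univ [Finite β] : PrimrecListable fun _ : π => (Set.univ : Set β) := by
  obtain ⟨l, -, hl⟩ := Finite.exists_univ_list β
  exact (list (Primrec.const l)).of_eq fun _ b => by simp [hl]

theorem sep {R : π → β → Prop} (hs : PrimrecListable s) (hR : PrimrecRel R) :
    PrimrecListable fun p => {b | b ∈ s p ∧ R p b} := by
  classical
  obtain ⟨g, hg, hgs⟩ := hs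
  exact ⟨fun p => (g p).filter fun b => R p b, hR.swap.listFilter.comp hg Primrec.id, by
    simp [hgs]⟩

theorem image {F : π → β → γ} (hs : PrimrecListable s) (hF : Primrec₂ F) :
    PrimrecListable fun p => F p '' s p := by
  obtain ⟨g, hg, hgs⟩ := hs
  exact ⟨fun p => (g p).map (F p), Primrec.list_map hg hF, by simp [hgs]⟩

theorem union {s' : π → Set β} (hs : PrimrecListable s) (hs' : PrimrecListable s') :
    PrimrecListable fun p => s p ∪ s' p := by
  obtain ⟨g, hg, hgs⟩ := hs
  obtain ⟨g', hg', hgs'⟩ := hs'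
  exact ⟨fun p => g p ++ g' p, Primrec.list_append.comp hg hg', by simp [hgs, hgs']⟩

theorem prod (hs : PrimrecListable s) (ht : PrimrecListable t) :
    PrimrecListable fun p => s p ×ˢ t p := by
  obtain ⟨g, hg, hgs⟩ := hs
  obtain ⟨g', hg', hgt⟩ := ht
  refine ⟨fun p => (g p).flatMap fun b => (g' p).map fun c => (b, c), ?_, ?_⟩
  · exact Primrec.list_flatMap hg (Primrec.list_map (hg'.comp Primrec.fst)
      (Primrec.pair (Primrec.snd.comp Primrec.fst) Primrec.snd))
  · rintro p ⟨b, c⟩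
    simp [hgs, hgt]

theorem words (hs : PrimrecListable s) {n : π → ℕ} (hn : Primrec n) :
    PrimrecListable fun p => {l : List β | l.length ≤ n p ∧ ∀ b ∈ l, b ∈ s p} := by
  obtain ⟨g, hg, hgs⟩ := hs
  refine ⟨fun p => wordsUpTo (g p) (n p), ?_, fun p l => ?_⟩
  · refine Primrec.nat_rec' (h := fun p (q : ℕ × List (List β)) =>
      [] :: (g p).flatMap fun b => q.2.map fun l => b :: l) hn (Primrec.const _) ?_
    refine Primrec.list_cons.comp (Primrec.const []) ?_
    refine Primrec.list_flatMap (hg.comp Primrec.fst) ?_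
    refine Primrec.list_map (Primrec.snd.comp (Primrec.snd.comp Primrec.fst)) ?_
    exact Primrec.list_cons.comp (Primrec.snd.comp Primrec.fst) Primrec.snd
  · simp [mem_wordsUpTo, hgs]

end PrimrecListable

end Listable

/-! ### Primitive recursiveness of the operations on words, contexts and templates -/

section PrimitiveRecursion

variable {β σ : Type*} [Primcodable β] [Primcodable σ]

theorem primrec₂_zip {γ : Type*} [Primcodable γ] (b₀ : β) (c₀ : γ) :
    Primrec₂ (List.zip : List β → List γ → List (β × γ)) := by
  -- The default values are never read, but `List.getD` is total.
  have h1 : Primrec fun p : List β × List γ =>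
      (List.range (min p.1.length p.2.length)).map fun i => (p.1.getD i b₀, p.2.getD i c₀) := by
    refine Primrec.list_map (Primrec.list_range.comp (Primrec.nat_min.comp
      (Primrec.list_length.comp Primrec.fst) (Primrec.list_length.comp Primrec.snd))) ?_
    exact Primrec.pair
      ((Primrec.list_getD b₀).comp (Primrec.fst.comp Primrec.fst) Primrec.snd)
      ((Primrec.list_getD c₀).comp (Primrec.snd.comp Primrec.fst) Primrec.snd)
  refine h1.of_eq fun p => ?_
  apply List.ext_getElem
  · simp
  · intro i hi hi'
    simp only [List.length_map, List.length_range, lt_min_iff] at hi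
    simp [hi.1, hi.2]

theorem primrecRel_mem : PrimrecRel fun (b : β) (l : List β) => b ∈ l :=
  ((Primrec.eq (α := β)).exists_mem_list.swap).of_eq fun b l => by
    simp [Function.swap]

theorem perm_range_iff (l : List ℕ) (d : ℕ) :
    l.Perm (List.range d) ↔ l.length = d ∧ ∀ i ∈ List.range d, i ∈ l := by
  constructor
  · intro hl
    exact ⟨by simpa using hl.length_eq, fun i hi => hl.mem_iff.2 hi⟩
  · rintro ⟨hl, hi⟩
    exact (List.Subperm.perm_of_length_le (List.nodup_range.subperm hi) (by simp [hl])).symm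

theorem primrecRel_perm_range :
    PrimrecRel fun (l : List ℕ) (d : ℕ) => l.Perm (List.range d) := by
  have h1 : PrimrecRel fun (l : List ℕ) (d : ℕ) => ∀ i ∈ List.range d, i ∈ l :=
    (primrecRel_mem.forall_mem_list.comp (Primrec.list_range.comp Primrec.snd) Primrec.fst)
  have h2 : PrimrecRel fun (l : List ℕ) (d : ℕ) => l.length = d :=
    Primrec.eq.comp (Primrec.list_length.comp Primrec.fst) Primrec.snd
  exact (h2.and h1).of_eq fun p => (perm_range_iff p.1 p.2).symm

variable {α M : Type*} [Primcodable α] [Primcodable M]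

theorem primrec_tSym_cases {f : β → TSym α} {F : β → TSym α → σ} (hf : Primrec f)
    (hl : Primrec₂ fun b a => F b (.letter a)) (hx : Primrec₂ fun b i => F b (.x i))
    (hy : Primrec₂ fun b j => F b (.y j)) : Primrec fun b => F b (f b) := by
  have h1 : Primrec fun b => tSymEquiv α (f b) := Primrec.of_equiv.comp hf
  refine (Primrec.sumCasesOn h1 hl (Primrec.sumCasesOn (f := fun q : β × (ℕ ⊕ ℕ) => q.2)
    (g := fun q i => F q.1 (.x i)) (h := fun q j => F q.1 (.y j)) Primrec.snd ?_ ?_).to₂).of_eq ?_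
  · exact hx.comp (Primrec.fst.comp Primrec.fst) Primrec.snd
  · exact hy.comp (Primrec.fst.comp Primrec.fst) Primrec.snd
  · intro b
    cases f b <;> rfl

theorem primrec_getRight? : Primrec (Sum.getRight? : β ⊕ ℕ → Option ℕ) :=
  (Primrec.sumCasesOn Primrec.id (Primrec.const none).to₂
    (Primrec.option_some.comp Primrec.snd).to₂).of_eq fun s => by cases s <;> rfl

theorem primrec_letter : Primrec (TSym.letter : α → TSym α) :=
  (Primrec.of_equiv_symm (e := tSymEquiv α)).comp Primrec.sumInl

theorem primrec_x : Primrec (TSym.x : ℕ → TSym α) :=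
  (Primrec.of_equiv_symm (e := tSymEquiv α)).comp (Primrec.sumInr.comp Primrec.sumInl)

theorem primrec_y : Primrec (TSym.y : ℕ → TSym α) :=
  (Primrec.of_equiv_symm (e := tSymEquiv α)).comp (Primrec.sumInr.comp Primrec.sumInr)

theorem primrec_xVars : Primrec (xVars : List (TSym α) → List ℕ) := by
  refine Primrec.listFilterMap Primrec.id ?_
  exact primrec_tSym_cases (F := fun (_ : List (TSym α) × TSym α) (s : TSym α) => match s with
    | TSym.x i => some i
    | _ => none) Primrec.snd (Primrec.const none).to₂ (Primrec.option_some.comp Primrec.snd).to₂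
    (Primrec.const none).to₂

theorem primrec_yVars : Primrec (yVars : List (TSym α) → List ℕ) := by
  refine Primrec.listFilterMap Primrec.id ?_
  exact primrec_tSym_cases (F := fun (_ : List (TSym α) × TSym α) (s : TSym α) => match s with
    | TSym.y i => some i
    | _ => none) Primrec.snd (Primrec.const none).to₂ (Primrec.const none).to₂
    (Primrec.option_some.comp Primrec.snd).to₂

theorem primrec_applyTemplate : Primrec fun q : Template α × List (List α) × List (List α) =>
    applyTemplate q.1 q.2.1 q.2.2 := by
  refine Primrec.list_map Primrec.fst (Primrec.list_flatMap Primrec.snd ?_)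
  refine primrec_tSym_cases
    (F := fun (q : ((Template α × List (List α) × List (List α)) × List (TSym α)) × TSym α) s =>
      match s with
      | TSym.letter a => [a]
      | TSym.x i => q.1.1.2.1.getD i []
      | TSym.y j => q.1.1.2.2.getD j []) Primrec.snd ?_ ?_ ?_
  · exact (Primrec.list_cons.comp Primrec.snd (Primrec.const [])).to₂
  · exact (Primrec.list_getD []).comp (Primrec.fst.comp (Primrec.snd.comp
      (Primrec.fst.comp (Primrec.fst.comp Primrec.fst)))) Primrec.snd
  · exact (Primrec.list_getD []).comp (Primrec.snd.comp (Primrec.snd.comp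
      (Primrec.fst.comp (Primrec.fst.comp Primrec.fst)))) Primrec.snd

theorem primrec₂_fill : Primrec₂ (fill : List (α ⊕ ℕ) → List (List α) → List α) := by
  refine Primrec.list_flatMap Primrec.fst ?_
  refine (Primrec.sumCasesOn (f := fun q : (List (α ⊕ ℕ) × List (List α)) × (α ⊕ ℕ) => q.2)
    (g := fun _ a => [a]) (h := fun q i => q.1.2.getD i []) Primrec.snd ?_ ?_).of_eq ?_
  · exact (Primrec.list_cons.comp Primrec.snd (Primrec.const [])).to₂
  · exact (Primrec.list_getD []).comp (Primrec.snd.comp (Primrec.fst.comp Primrec.fst)) Primrec.snd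
  · rintro ⟨q, _ | _⟩ <;> rfl

theorem primrecRel_isContext : PrimrecRel (IsContext : ℕ → List (α ⊕ ℕ) → Prop) :=
  primrecRel_perm_range.comp
    (Primrec.listFilterMap Primrec.snd (primrec_getRight?.comp Primrec.snd).to₂) Primrec.fst

theorem primrec_typedTuple_mk :
    Primrec₂ (TypedTuple.mk : List (List α) → Iface M → TypedTuple α M) :=
  Primrec.of_equiv_symm (e := typedTupleEquiv α M)

theorem primrec_typedTuple_tuple : Primrec (TypedTuple.tuple : TypedTuple α M → _) :=
  Primrec.fst.comp (Primrec.of_equiv (e := typedTupleEquiv α M))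

theorem primrec_typedTuple_iface : Primrec (TypedTuple.iface : TypedTuple α M → _) :=
  Primrec.snd.comp (Primrec.of_equiv (e := typedTupleEquiv α M))

theorem primrec_rule_start : Primrec (Rule.start : β → Rule α β) :=
  (Primrec.of_equiv_symm (e := ruleEquiv α β)).comp (Primrec.sumInl.comp Primrec.sumInl)

theorem primrec₂_rule_terminal : Primrec₂ (Rule.terminal : β → α → Rule α β) :=
  (Primrec.of_equiv_symm (e := ruleEquiv α β)).comp (Primrec.sumInl.comp Primrec.sumInr)

theorem primrec_rule_binary : Primrec fun q : β × Template α × β × β =>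
    (Rule.binary q.1 q.2.1 q.2.2.1 q.2.2.2 : Rule α β) :=
  (Primrec.of_equiv_symm (e := ruleEquiv α β)).comp (Primrec.sumInr.comp Primrec.sumInl)

theorem primrec₂_rule_unit : Primrec₂ (Rule.unit : β → β → Rule α β) :=
  (Primrec.of_equiv_symm (e := ruleEquiv α β)).comp (Primrec.sumInr.comp Primrec.sumInr)

variable [Monoid M]

theorem primrec_trace {D : β → TSym α → M ⊕ ℕ} (hD : Primrec₂ D) :
    Primrec fun q : β × Template α × Iface M => trace (D q.1) q.2.1 q.2.2 := by
  have h1 : Primrec fun q : β × Template α × Iface M =>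
      (List.casesOn q.2.2.2 [] fun m ms => Sum.inl m :: (q.2.2.1.zip ms).flatMap fun p =>
        (q.2.1.getD p.1 []).map (D q.1) ++ [Sum.inl p.2] : List (M ⊕ ℕ)) := by
    refine Primrec.list_casesOn (f := fun q : β × Template α × Iface M => q.2.2.2)
      (h := fun q r => Sum.inl r.1 :: (q.2.2.1.zip r.2).flatMap fun p =>
        (q.2.1.getD p.1 []).map (D q.1) ++ [Sum.inl p.2])
      (Primrec.snd.comp (Primrec.snd.comp Primrec.snd)) (Primrec.const []) ?_
    refine Primrec.list_cons.comp (Primrec.sumInl.comp (Primrec.fst.comp Primrec.snd)) ?_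
    refine Primrec.list_flatMap ((primrec₂_zip 0 1).comp (Primrec.fst.comp (Primrec.snd.comp
      (Primrec.snd.comp Primrec.fst))) (Primrec.snd.comp Primrec.snd)) ?_
    refine Primrec.list_append.comp (Primrec.list_map ?_ ?_) ?_
    · exact (Primrec.list_getD []).comp
        (Primrec.fst.comp (Primrec.snd.comp (Primrec.fst.comp Primrec.fst)))
        (Primrec.fst.comp Primrec.snd)
    · exact hD.comp (Primrec.fst.comp (Primrec.fst.comp (Primrec.fst.comp Primrec.fst)))
        Primrec.snd
    · exact Primrec.list_cons.comp (Primrec.sumInl.comp (Primrec.snd.comp Primrec.snd))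
        (Primrec.const [])
  refine h1.of_eq ?_
  rintro ⟨b, ρ, σ, _ | ⟨m, ms⟩⟩ <;> rfl

variable [Finite α] (h : FreeMonoid α →* M)

theorem primrec₂_decB : Primrec₂ (decB h) := by
  refine primrec_tSym_cases (F := fun q : List M × TSym α => decB h q.1) Primrec.snd ?_ ?_ ?_
  · exact (Primrec.sumInl.comp
      ((Primrec.dom_finite fun a => h (FreeMonoid.of a)).comp Primrec.snd)).to₂
  · exact (Primrec.sumInr.comp Primrec.snd).to₂
  · exact (Primrec.sumInl.comp ((Primrec.list_getD 1).comp (Primrec.fst.comp Primrec.fst)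
      Primrec.snd)).to₂

theorem primrec₂_decC : Primrec₂ (decC h) := by
  refine primrec_tSym_cases (F := fun q : List M × TSym α => decC h q.1) Primrec.snd ?_ ?_ ?_
  · exact (Primrec.sumInl.comp
      ((Primrec.dom_finite fun a => h (FreeMonoid.of a)).comp Primrec.snd)).to₂
  · exact (Primrec.sumInl.comp ((Primrec.list_getD 1).comp (Primrec.fst.comp Primrec.fst)
      Primrec.snd)).to₂
  · exact (Primrec.sumInr.comp Primrec.snd).to₂

variable [Finite M]

theorem primrec₂_monoid_mul : Primrec₂ fun m n : M => m * n :=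
  Primrec.dom_finite fun p : M × M => p.1 * p.2

theorem primrec_blockProducts : Primrec (blockProducts : List (M ⊕ ℕ) → List M) := by
  have h1 : Primrec fun w : List (M ⊕ ℕ) => w.foldr (fun s L =>
      (Sum.casesOn s (fun m => L.modifyHead fun n => m * n) (fun _ => 1 :: L) : List M)) [1] := by
    refine Primrec.list_foldr (h := fun _ (q : (M ⊕ ℕ) × List M) => (Sum.casesOn q.1
      (fun m => q.2.modifyHead fun n => m * n) (fun _ => 1 :: q.2) : List M))
      Primrec.id (Primrec.const _) ?_
    refine Primrec.sumCasesOn (Primrec.fst.comp Primrec.snd) ?_ ?_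
    · exact (Primrec.list_modifyHead' primrec₂_monoid_mul).comp
        (Primrec.snd.comp (Primrec.snd.comp Primrec.fst)) Primrec.snd
    · exact Primrec.list_cons.comp (Primrec.const 1)
        (Primrec.snd.comp (Primrec.snd.comp Primrec.fst))
  refine h1.of_eq fun w => ?_
  induction w with
  | nil => rfl
  | cons s w ih => cases s <;> simp [blockProducts, ← ih]

theorem primrec_normalForm : Primrec (normalForm : List (M ⊕ ℕ) → Iface M) :=
  Primrec.pair (Primrec.listFilterMap Primrec.id (primrec_getRight?.comp Primrec.snd).to₂)
    primrec_blockProducts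

theorem primrec_transportB : Primrec fun q : List M × Template α × Iface M =>
    transportB h q.2.1 q.2.2 q.1 :=
  primrec_normalForm.comp (primrec_trace (primrec₂_decB h))

theorem primrec_transportC : Primrec fun q : List M × Template α × Iface M =>
    transportC h q.2.1 q.2.2 q.1 :=
  primrec_normalForm.comp (primrec_trace (primrec₂_decC h))

theorem primrec_ifaceType : Primrec (ifaceType h) := by
  refine primrec_normalForm.comp (Primrec.list_map Primrec.id ?_)
  refine (Primrec.sumCasesOn (f := fun q : List (α ⊕ ℕ) × (α ⊕ ℕ) => q.2)
    (g := fun _ a => (Sum.inl (h (FreeMonoid.of a)) : M ⊕ ℕ)) (h := fun _ i => Sum.inr i)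
    Primrec.snd ?_ ?_).of_eq ?_
  · exact (Primrec.sumInl.comp
      ((Primrec.dom_finite fun a => h (FreeMonoid.of a)).comp Primrec.snd)).to₂
  · exact (Primrec.sumInr.comp Primrec.snd).to₂
  · rintro ⟨q, _ | _⟩ <;> rfl

theorem primrec_hWord : Primrec (hWord h) := by
  have h1 : Primrec fun w : List α => w.foldr (fun a m => h (FreeMonoid.of a) * m) 1 := by
    refine Primrec.list_foldr (h := fun _ q => h (FreeMonoid.of q.1) * q.2)
      Primrec.id (Primrec.const _) ?_
    exact primrec₂_monoid_mul.comp
      ((Primrec.dom_finite fun a => h (FreeMonoid.of a)).comp (Primrec.fst.comp Primrec.snd))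
      (Primrec.snd.comp Primrec.snd)
  refine h1.of_eq fun w => ?_
  induction w with
  | nil => exact (hWord_nil h).symm
  | cons a w ih => rw [hWord_cons, ← ih]; rfl

theorem primrec_hType : Primrec (hType h) :=
  Primrec.list_map Primrec.id ((primrec_hWord h).comp Primrec.snd).to₂

end PrimitiveRecursion

/-! ### Bounds on contexts, tuples and templates -/

section LengthBounds

variable {α : Type*}

theorem length_getD_le_fill {d i : ℕ} {E : List (α ⊕ ℕ)} (hE : IsContext d E) (hi : i < d)
    (x : List (List α)) : (x.getD i []).length ≤ (fill E x).length := by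
  have h1 : i ∈ E.filterMap Sum.getRight? := hE.mem_iff.2 (List.mem_range.2 hi)
  obtain ⟨s, hs, hsi⟩ := List.mem_filterMap.1 h1
  cases s with
  | inl a => simp at hsi
  | inr j =>
    obtain rfl : j = i := by simpa using hsi
    have h2 : (x.getD j []).Sublist (fill E x) :=
      List.sublist_flatten_of_mem (List.mem_map.2 ⟨Sum.inr j, hs, rfl⟩)
    exact h2.length_le

theorem length_le_fill_of_mem {E : List (α ⊕ ℕ)} {x : List (List α)}
    (hE : IsContext x.length E) {v : List α} (hv : v ∈ x) : v.length ≤ (fill E x).length := by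
  obtain ⟨i, hi, rfl⟩ := List.mem_iff_getElem.1 hv
  simpa [hi] using length_getD_le_fill hE hi x

/-- Every symbol of a context is either a letter of the filled word or one of the `d` holes. -/
theorem length_context_le {d : ℕ} {E : List (α ⊕ ℕ)} (hE : IsContext d E) (x : List (List α)) :
    E.length ≤ (fill E x).length + d := by
  have h1 : ∀ E : List (α ⊕ ℕ),
      E.length ≤ (fill E x).length + (E.filterMap Sum.getRight?).length := by
    intro E
    induction E with
    | nil => simp
    | cons s E ih =>
      cases s with
      | inl a =>
        have h2 : fill (Sum.inl a :: E) x = a :: fill E x := rfl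
        rw [h2, filterMap_inl_cons]
        simp only [List.length_cons]
        omega
      | inr i =>
        have h2 : fill (Sum.inr i :: E) x = x.getD i [] ++ fill E x := rfl
        have h3 : (Sum.inr i :: E).filterMap Sum.getRight? = i :: E.filterMap Sum.getRight? := rfl
        rw [h2, h3]
        simp only [List.length_cons, List.length_append]
        omega
  have h2 : (E.filterMap Sum.getRight?).length = d := by simpa using hE.length_eq
  exact h2 ▸ h1 E

theorem length_word_le (l : List (TSym α)) (u v : List (List α)) :
    l.length ≤ (substWord u v l).length + (xVars l).length + (yVars l).length := by
  induction l with
  | nil => simp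
  | cons s l ih =>
    cases s with
    | letter a =>
      have h1 : substWord u v (TSym.letter a :: l) = a :: substWord u v l := rfl
      have h2 : xVars (TSym.letter a :: l) = xVars l := rfl
      have h3 : yVars (TSym.letter a :: l) = yVars l := rfl
      rw [h1, h2, h3]
      simp only [List.length_cons]
      omega
    | x i =>
      have h1 : substWord u v (TSym.x i :: l) = u.getD i [] ++ substWord u v l := rfl
      have h2 : xVars (TSym.x i :: l) = i :: xVars l := rfl
      have h3 : yVars (TSym.x i :: l) = yVars l := rfl
      rw [h1, h2, h3]
      simp only [List.length_cons, List.length_append]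
      omega
    | y j =>
      have h1 : substWord u v (TSym.y j :: l) = v.getD j [] ++ substWord u v l := rfl
      have h2 : xVars (TSym.y j :: l) = xVars l := rfl
      have h3 : yVars (TSym.y j :: l) = j :: yVars l := rfl
      rw [h1, h2, h3]
      simp only [List.length_cons, List.length_append]
      omega

theorem mem_xVars_iff {l : List (TSym α)} {i : ℕ} : i ∈ xVars l ↔ TSym.x i ∈ l := by
  simp only [xVars, List.mem_filterMap]
  constructor
  · rintro ⟨s, hs, hsi⟩
    cases s <;> simp_all
  · exact fun hi => ⟨_, hi, rfl⟩

theorem mem_yVars_iff {l : List (TSym α)} {j : ℕ} : j ∈ yVars l ↔ TSym.y j ∈ l := by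
  simp only [yVars, List.mem_filterMap]
  constructor
  · rintro ⟨s, hs, hsi⟩
    cases s <;> simp_all
  · exact fun hi => ⟨_, hi, rfl⟩

/-- Every letter of a template word survives substitution, and every variable occurs once. -/
theorem IsTemplate.length_le {e dB dC : ℕ} {ρ : Template α} (hρ : IsTemplate e dB dC ρ)
    {l : List (TSym α)} (hl : l ∈ ρ) (u v : List (List α)) :
    l.length ≤ (substWord u v l).length + dB + dC := by
  have hs := List.sublist_flatten_of_mem hl
  have hx : (xVars l).length ≤ (xVars ρ.flatten).length := (hs.filterMap _).length_le
  have hy : (yVars l).length ≤ (yVars ρ.flatten).length := (hs.filterMap _).length_le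
  rw [hρ.2.1.length_eq, List.length_range] at hx
  rw [hρ.2.2.length_eq, List.length_range] at hy
  have := length_word_le l u v
  omega

theorem IsTemplate.x_lt {e dB dC : ℕ} {ρ : Template α} (hρ : IsTemplate e dB dC ρ)
    {l : List (TSym α)} (hl : l ∈ ρ) {i : ℕ} (hi : TSym.x i ∈ l) : i < dB :=
  List.mem_range.1 (hρ.2.1.mem_iff.1 (mem_xVars_iff.2 (List.mem_flatten.2 ⟨l, hl, hi⟩)))

theorem IsTemplate.y_lt {e dB dC : ℕ} {ρ : Template α} (hρ : IsTemplate e dB dC ρ)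
    {l : List (TSym α)} (hl : l ∈ ρ) {j : ℕ} (hj : TSym.y j ∈ l) : j < dC :=
  List.mem_range.1 (hρ.2.2.mem_iff.1 (mem_yVars_iff.2 (List.mem_flatten.2 ⟨l, hl, hj⟩)))

theorem IsContext.inr_lt {d : ℕ} {E : List (α ⊕ ℕ)} (hE : IsContext d E) {i : ℕ}
    (hi : Sum.inr i ∈ E) : i < d :=
  List.mem_range.1 (hE.mem_iff.1 (List.mem_filterMap.2 ⟨_, hi, rfl⟩))

theorem length_le_length_flatten {p : List (List α)} {w : List α} (hw : w ∈ p) :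
    w.length ≤ p.flatten.length :=
  (List.sublist_flatten_of_mem hw).length_le

end LengthBounds

/-! ### Computability of the learner grammar -/

section LearnerComputability

variable {α M : Type*} [Primcodable α] [Monoid M] [Primcodable M]

theorem primrec_sampleLength : Primrec fun p : List (List α) => p.flatten.length :=
  Primrec.list_length.comp Primrec.list_flatten

theorem primrecRel_isTemplate : PrimrecRel fun (ds : ℕ × ℕ × ℕ) (ρ : Template α) =>
    IsTemplate ds.1 ds.2.1 ds.2.2 ρ := by
  have hfl : Primrec fun q : (ℕ × ℕ × ℕ) × Template α => q.2.flatten :=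
    Primrec.list_flatten.comp Primrec.snd
  refine PrimrecPred.and ?_ (PrimrecPred.and ?_ ?_)
  · exact Primrec.eq.comp (Primrec.list_length.comp Primrec.snd) (Primrec.fst.comp Primrec.fst)
  · exact primrecRel_perm_range.comp (primrec_xVars.comp hfl)
      (Primrec.fst.comp (Primrec.snd.comp Primrec.fst))
  · exact primrecRel_perm_range.comp (primrec_yVars.comp hfl)
      (Primrec.snd.comp (Primrec.snd.comp Primrec.fst))

theorem listable_start {f : ℕ} (hf : 1 ≤ f) (h : FreeMonoid α →* M) :
    PrimrecListable fun p : List (List α) => {r : Rule α (LearnerNT α M) | ∃ w ∈ p,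
      ObservedVia f h {w | w ∈ p} [Sum.inr 0] ⟨[w], ifaceType h [Sum.inr 0]⟩ ∧
      r = Rule.start (some ⟨[w], ifaceType h [Sum.inr 0]⟩)} := by
  have h1 : Primrec₂ fun (_ : List (List α)) (w : List α) =>
      (Rule.start (some ⟨[w], ifaceType h [Sum.inr 0]⟩) : Rule α (LearnerNT α M)) :=
    primrec_rule_start.comp (Primrec.option_some.comp (primrec_typedTuple_mk.comp
      (Primrec.list_cons.comp Primrec.snd (Primrec.const [])) (Primrec.const _)))
  refine ((PrimrecListable.list Primrec.id).image h1).of_eq fun p r => ?_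
  constructor
  · rintro ⟨w, hw, rfl⟩
    exact ⟨w, hw, ⟨le_rfl, hf, isContext_hole, by rwa [fill_hole], rfl⟩, rfl⟩
  · rintro ⟨w, hw, -, rfl⟩
    exact ⟨w, hw, rfl⟩

variable [Finite α] [Finite M]

theorem listable_tuples (f : ℕ) : PrimrecListable fun p : List (List α) =>
    {x : List (List α) | x.length ≤ f ∧ ∀ v ∈ x, v.length ≤ p.flatten.length} :=
  ((PrimrecListable.univ.words primrec_sampleLength).words (Primrec.const f)).of_eq
    fun p x => by simp

theorem listable_contexts (f : ℕ) : PrimrecListable fun p : List (List α) =>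
    {E : List (α ⊕ ℕ) | E.length ≤ p.flatten.length + f ∧ ∀ i, Sum.inr i ∈ E → i < f} := by
  have h1 : PrimrecListable fun _ : List (List α) => {s : α ⊕ ℕ | ∀ i, s = Sum.inr i → i < f} :=
    ((PrimrecListable.univ.image (F := fun (_ : List (List α)) (a : α) => (Sum.inl a : α ⊕ ℕ))
      (Primrec.sumInl.comp Primrec.snd).to₂).union
      ((PrimrecListable.list (Primrec.const (List.range f))).image
        (Primrec.sumInr.comp Primrec.snd).to₂)).of_eq fun p s => by cases s <;> simp
  refine (h1.words (Primrec.nat_add.comp primrec_sampleLength (Primrec.const f))).of_eq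
    fun p E => ?_
  simp only [Set.mem_ofPred_eq]
  exact and_congr_right fun _ => ⟨fun H i hi => H _ hi i rfl, fun H s hs i hi => H i (hi ▸ hs)⟩

theorem listable_templates (f : ℕ) : PrimrecListable fun p : List (List α) =>
    {ρ : Template α | ρ.length ≤ f ∧ ∀ l ∈ ρ, l.length ≤ p.flatten.length + (f + f) ∧
      (∀ i, TSym.x i ∈ l → i < f) ∧ ∀ j, TSym.y j ∈ l → j < f} := by
  have h1 : PrimrecListable fun _ : List (List α) =>
      {s : TSym α | (∀ i, s = .x i → i < f) ∧ ∀ j, s = .y j → j < f} :=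
    ((PrimrecListable.univ.image (F := fun (_ : List (List α)) (a : α) => TSym.letter a)
      (primrec_letter.comp Primrec.snd).to₂).union
      (((PrimrecListable.list (Primrec.const (List.range f))).image
        (primrec_x.comp Primrec.snd).to₂).union
      ((PrimrecListable.list (Primrec.const (List.range f))).image
        (primrec_y.comp Primrec.snd).to₂))).of_eq fun p s => by cases s <;> simp
  refine ((h1.words (Primrec.nat_add.comp primrec_sampleLength (Primrec.const (f + f)))).words
    (Primrec.const f)).of_eq fun p ρ => ?_
  simp only [Set.mem_ofPred_eq]
  refine and_congr_right fun _ => forall₂_congr fun l _ => and_congr_right fun _ => ?_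
  exact ⟨fun H => ⟨fun i hi => (H _ hi).1 i rfl, fun j hj => (H _ hj).2 j rfl⟩,
    fun H s hs => ⟨fun i hi => H.1 i (hi ▸ hs), fun j hj => H.2 j (hj ▸ hs)⟩⟩

variable (f : ℕ) (h : FreeMonoid α →* M)

theorem listable_observedVia : PrimrecListable fun p : List (List α) =>
    {q : List (α ⊕ ℕ) × TypedTuple α M | ObservedVia f h {w | w ∈ p} q.1 q.2} := by
  have h1 : PrimrecRel fun (p : List (List α)) (q : List (α ⊕ ℕ) × List (List α)) =>
      1 ≤ q.2.length ∧ IsContext q.2.length q.1 ∧ fill q.1 q.2 ∈ p := by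
    have hE : Primrec fun r : List (List α) × List (α ⊕ ℕ) × List (List α) => r.2.1 :=
      Primrec.fst.comp Primrec.snd
    have hx : Primrec fun r : List (List α) × List (α ⊕ ℕ) × List (List α) => r.2.2 :=
      Primrec.snd.comp Primrec.snd
    have hl := Primrec.list_length.comp hx
    exact (Primrec.nat_le.comp (Primrec.const 1) hl).and
      ((primrecRel_isContext.comp hl hE).and
        (primrecRel_mem.comp (primrec₂_fill.comp hE hx) Primrec.fst))
  have h2 : Primrec₂ fun (_ : List (List α)) (q : List (α ⊕ ℕ) × List (List α)) =>
      (q.1, (⟨q.2, ifaceType h q.1⟩ : TypedTuple α M)) := by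
    have hE : Primrec fun r : List (List α) × List (α ⊕ ℕ) × List (List α) => r.2.1 :=
      Primrec.fst.comp Primrec.snd
    exact hE.pair (primrec_typedTuple_mk.comp (Primrec.snd.comp Primrec.snd)
      ((primrec_ifaceType h).comp hE))
  refine ((((listable_contexts f).prod (listable_tuples f)).sep h1).image h2).of_eq ?_
  rintro p ⟨E, ⟨x, τ⟩⟩
  simp only [Set.mem_image, Set.mem_ofPred_eq, Set.mem_prod, Prod.exists, Prod.mk.injEq,
    TypedTuple.mk.injEq, ObservedVia]
  constructor
  · rintro ⟨E', x', ⟨⟨-, hx, -⟩, h1, hE, hf⟩, rfl, rfl, rfl⟩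
    exact ⟨h1, hx, hE, hf, rfl⟩
  · rintro ⟨h1, hx, hE, hf, rfl⟩
    have hlen := length_le_length_flatten hf
    refine ⟨E, x, ⟨⟨⟨?_, fun i hi => (hE.inr_lt hi).trans_le hx⟩, hx, fun v hv => ?_⟩,
      h1, hE, hf⟩, rfl, rfl, rfl⟩
    · exact (length_context_le hE x).trans (add_le_add hlen hx)
    · exact (length_le_fill_of_mem hE hv).trans hlen

theorem listable_observed : PrimrecListable fun p : List (List α) =>
    {t : TypedTuple α M | Observed f h {w | w ∈ p} t} :=
  ((listable_observedVia f h).image (F := fun _ q => q.2) (Primrec.snd.comp Primrec.snd).to₂).of_eq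
    fun p t => by simp [Observed]

theorem listable_nonterms : PrimrecListable fun p : List (List α) =>
    {q : LearnerNT α M × ℕ | q.1 ∈ (learnerGrammar f h {w | w ∈ p}).nonterms ∧
      q.2 = (learnerGrammar f h {w | w ∈ p}).fanout q.1} := by
  have h1 : Primrec₂ fun (_ : List (List α)) (t : TypedTuple α M) =>
      ((some t, t.tuple.length) : LearnerNT α M × ℕ) :=
    (Primrec.option_some.comp Primrec.snd).pair
      (Primrec.list_length.comp (primrec_typedTuple_tuple.comp Primrec.snd))
  refine ((PrimrecListable.list (Primrec.const [((none, 1) : LearnerNT α M × ℕ)])).union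
    ((listable_observed f h).image h1)).of_eq ?_
  rintro p ⟨_ | t, d⟩ <;> simp [learnerGrammar, eq_comm]

theorem listable_binary : PrimrecListable fun p : List (List α) =>
    {r : Rule α (LearnerNT α M) | ∃ t ρ b c, TypedWitness f h {w | w ∈ p} t ρ b c ∧
      r = Rule.binary (some t) ρ (some b) (some c)} := by
  let Q := TypedTuple α M × Template α × TypedTuple α M × TypedTuple α M
  have ht : Primrec fun r : List (List α) × Q => r.2.1 := Primrec.fst.comp Primrec.snd
  have hρ : Primrec fun r : List (List α) × Q => r.2.2.1 :=
    Primrec.fst.comp (Primrec.snd.comp Primrec.snd)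
  have hb : Primrec fun r : List (List α) × Q => r.2.2.2.1 :=
    Primrec.fst.comp (Primrec.snd.comp (Primrec.snd.comp Primrec.snd))
  have hc : Primrec fun r : List (List α) × Q => r.2.2.2.2 :=
    Primrec.snd.comp (Primrec.snd.comp (Primrec.snd.comp Primrec.snd))
  have htl := Primrec.list_length.comp (primrec_typedTuple_tuple.comp ht)
  have hbl := Primrec.list_length.comp (primrec_typedTuple_tuple.comp hb)
  have hcl := Primrec.list_length.comp (primrec_typedTuple_tuple.comp hc)
  have h1 : PrimrecRel fun (_ : List (List α)) (q : Q) =>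
      IsTemplate q.1.tuple.length q.2.2.1.tuple.length q.2.2.2.tuple.length q.2.1 ∧
      applyTemplate q.2.1 q.2.2.1.tuple q.2.2.2.tuple = q.1.tuple ∧
      transportB h q.2.1 q.1.iface (hType h q.2.2.2.tuple) = q.2.2.1.iface ∧
      transportC h q.2.1 q.1.iface (hType h q.2.2.1.tuple) = q.2.2.2.iface := by
    refine PrimrecPred.and ?_ (PrimrecPred.and ?_ (PrimrecPred.and ?_ ?_))
    · exact primrecRel_isTemplate.comp (htl.pair (hbl.pair hcl)) hρ
    · exact Primrec.eq.comp (primrec_applyTemplate.comp (hρ.pair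
        ((primrec_typedTuple_tuple.comp hb).pair (primrec_typedTuple_tuple.comp hc))))
        (primrec_typedTuple_tuple.comp ht)
    · exact Primrec.eq.comp ((primrec_transportB h).comp
        (((primrec_hType h).comp (primrec_typedTuple_tuple.comp hc)).pair
          (hρ.pair (primrec_typedTuple_iface.comp ht)))) (primrec_typedTuple_iface.comp hb)
    · exact Primrec.eq.comp ((primrec_transportC h).comp
        (((primrec_hType h).comp (primrec_typedTuple_tuple.comp hb)).pair
          (hρ.pair (primrec_typedTuple_iface.comp ht)))) (primrec_typedTuple_iface.comp hc)
  have h2 : Primrec₂ fun (_ : List (List α)) (q : Q) =>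
      (Rule.binary (some q.1) q.2.1 (some q.2.2.1) (some q.2.2.2) : Rule α (LearnerNT α M)) :=
    primrec_rule_binary.comp ((Primrec.option_some.comp ht).pair (hρ.pair
      ((Primrec.option_some.comp hb).pair (Primrec.option_some.comp hc))))
  have hO := listable_observed f h
  refine (((hO.prod ((listable_templates f).prod (hO.prod hO))).sep h1).image h2).of_eq ?_
  intro p r
  constructor
  · rintro ⟨⟨t, ρ, b, c⟩, ⟨⟨ht, -, hb, hc⟩, hw⟩, rfl⟩
    exact ⟨t, ρ, b, c, ⟨ht, hb, hc, hw⟩, rfl⟩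
  · rintro ⟨t, ρ, b, c, ⟨ht, hb, hc, hw⟩, rfl⟩
    refine ⟨(t, ρ, b, c), ⟨⟨ht, ⟨?_, fun l hl => ⟨?_, ?_, ?_⟩⟩, hb, hc⟩, hw⟩, rfl⟩
    all_goals
      obtain ⟨Et, -, htf, hEt, htK, -⟩ := ht
      obtain ⟨-, -, hbf, -⟩ := hb
      obtain ⟨-, -, hcf, -⟩ := hc
    · exact hw.1.1.trans_le htf
    · have h3 : substWord b.tuple c.tuple l ∈ t.tuple := by
        rw [← hw.2.1]
        exact List.mem_map_of_mem hl
      have h4 := (length_le_fill_of_mem hEt h3).trans (length_le_length_flatten htK)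
      have h5 := hw.1.length_le hl b.tuple c.tuple
      omega
    · exact fun i hi => (hw.1.x_lt hl hi).trans_le hbf
    · exact fun j hj => (hw.1.y_lt hl hj).trans_le hcf

theorem listable_terminal : PrimrecListable fun p : List (List α) =>
    {r : Rule α (LearnerNT α M) | ∃ a τ, Observed f h {w | w ∈ p} ⟨[[a]], τ⟩ ∧
      r = Rule.terminal (some ⟨[[a]], τ⟩) a} := by
  have ha : Primrec fun r : List (List α) × α × TypedTuple α M => r.2.1 :=
    Primrec.fst.comp Primrec.snd
  have ht : Primrec fun r : List (List α) × α × TypedTuple α M => r.2.2 :=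
    Primrec.snd.comp Primrec.snd
  have h1 : PrimrecRel fun (_ : List (List α)) (q : α × TypedTuple α M) =>
      q.2.tuple = [[q.1]] :=
    Primrec.eq.comp (primrec_typedTuple_tuple.comp ht)
      (Primrec.list_cons.comp (Primrec.list_cons.comp ha (Primrec.const [])) (Primrec.const []))
  have h2 : Primrec₂ fun (_ : List (List α)) (q : α × TypedTuple α M) =>
      (Rule.terminal (some q.2) q.1 : Rule α (LearnerNT α M)) :=
    primrec₂_rule_terminal.comp (Primrec.option_some.comp ht) ha
  refine (((PrimrecListable.univ.prod (listable_observed f h)).sep h1).image h2).of_eq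
    fun p r => ?_
  constructor
  · rintro ⟨⟨a, x, τ⟩, ⟨⟨-, ht⟩, hx⟩, rfl⟩
    obtain rfl : x = [[a]] := hx
    exact ⟨a, τ, ht, rfl⟩
  · rintro ⟨a, τ, ht, rfl⟩
    exact ⟨(a, ⟨[[a]], τ⟩), ⟨⟨trivial, ht⟩, rfl⟩, rfl⟩

theorem listable_unit : PrimrecListable fun p : List (List α) =>
    {r : Rule α (LearnerNT α M) | ∃ x y E, x.length = y.length ∧ hType h x = hType h y ∧
      ObservedVia f h {w | w ∈ p} E ⟨x, ifaceType h E⟩ ∧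
      ObservedVia f h {w | w ∈ p} E ⟨y, ifaceType h E⟩ ∧
      r = Rule.unit (some ⟨x, ifaceType h E⟩) (some ⟨y, ifaceType h E⟩)} := by
  let Q := (List (α ⊕ ℕ) × TypedTuple α M) × (List (α ⊕ ℕ) × TypedTuple α M)
  have hs : Primrec fun r : List (List α) × Q => r.2.1.2 :=
    Primrec.snd.comp (Primrec.fst.comp Primrec.snd)
  have ht : Primrec fun r : List (List α) × Q => r.2.2.2 :=
    Primrec.snd.comp (Primrec.snd.comp Primrec.snd)
  have h1 : PrimrecRel fun (_ : List (List α)) (q : Q) => q.1.1 = q.2.1 ∧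
      q.1.2.tuple.length = q.2.2.tuple.length ∧ hType h q.1.2.tuple = hType h q.2.2.tuple := by
    refine PrimrecPred.and ?_ (PrimrecPred.and ?_ ?_)
    · exact Primrec.eq.comp (Primrec.fst.comp (Primrec.fst.comp Primrec.snd))
        (Primrec.fst.comp (Primrec.snd.comp Primrec.snd))
    · exact Primrec.eq.comp (Primrec.list_length.comp (primrec_typedTuple_tuple.comp hs))
        (Primrec.list_length.comp (primrec_typedTuple_tuple.comp ht))
    · exact Primrec.eq.comp ((primrec_hType h).comp (primrec_typedTuple_tuple.comp hs))
        ((primrec_hType h).comp (primrec_typedTuple_tuple.comp ht))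
  have h2 : Primrec₂ fun (_ : List (List α)) (q : Q) =>
      (Rule.unit (some q.1.2) (some q.2.2) : Rule α (LearnerNT α M)) :=
    primrec₂_rule_unit.comp (Primrec.option_some.comp hs) (Primrec.option_some.comp ht)
  have hO := listable_observedVia f h
  refine (((hO.prod hO).sep h1).image h2).of_eq fun p r => ?_
  constructor
  · rintro ⟨⟨⟨E, x, τ⟩, E', y, τ'⟩, ⟨⟨hx, hy⟩, hE, hlen, hxy⟩, rfl⟩
    simp only at hE hlen hxy
    subst hE
    obtain rfl : ifaceType h E = τ := hx.2.2.2.2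
    obtain rfl : ifaceType h E = τ' := hy.2.2.2.2
    exact ⟨x, y, E, hlen, hxy, hx, hy, rfl⟩
  · rintro ⟨x, y, E, hlen, hxy, hx, hy, rfl⟩
    exact ⟨((E, ⟨x, _⟩), (E, ⟨y, _⟩)), ⟨⟨hx, hy⟩, rfl, hlen, hxy⟩, rfl⟩

theorem listable_rules (hf : 1 ≤ f) : PrimrecListable fun p : List (List α) =>
    (learnerGrammar f h {w | w ∈ p}).rules := by
  refine ((listable_start hf h).union ((listable_terminal f h).union
    ((listable_binary f h).union (listable_unit f h)))).of_eq fun p r => ?_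
  constructor
  · rintro (⟨w, hw, hO, rfl⟩ | ⟨a, τ, hO, rfl⟩ | ⟨t, ρ, b, c, hw, rfl⟩ |
      ⟨x, y, E, hlen, hxy, hx, hy, rfl⟩)
    · exact LearnerRule.start hw hO
    · exact LearnerRule.terminal hO
    · exact LearnerRule.binary hw
    · exact LearnerRule.subst hlen hxy hx hy
  · intro hr
    cases hr with
    | start hw hO => exact Or.inl ⟨_, hw, hO, rfl⟩
    | terminal hO => exact Or.inr (Or.inl ⟨_, _, hO, rfl⟩)
    | binary hw => exact Or.inr (Or.inr (Or.inl ⟨_, _, _, _, hw, rfl⟩))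
    | subst hlen hxy hx hy =>
      exact Or.inr (Or.inr (Or.inr ⟨_, _, _, hlen, hxy, hx, hy, rfl⟩))

theorem computableLearner_learnerGrammar (hf : 1 ≤ f) :
    ComputableLearner fun p : List (List α) => learnerGrammar f h {w | w ∈ p} := by
  obtain ⟨g₁, hg₁, hN⟩ := listable_nonterms f h
  obtain ⟨g₂, hg₂, hR⟩ := listable_rules f h hf
  refine ⟨fun p => (g₁ p, none, g₂ p), ?_, fun p => ⟨fun A d => hN p (A, d), rfl, hR p⟩⟩
  exact (hg₁.pair ((Primrec.const none).pair hg₂)).to_comp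

end LearnerComputability

end TupleLearning

theorem corollary8p11 {α : Type*} [Finite α] [Primcodable α]
    {M : Type*} [Monoid M] [Finite M] [Primcodable M]
    (f : ℕ) (hf : 1 ≤ f) (h : FreeMonoid α →* M) :
    ∃ 𝒜 : List (List α) → TupleLearning.Grammar α (TupleLearning.LearnerNT α M),
      TupleLearning.IdentifiesInLimit 𝒜 (TupleLearning.tupleClass f h) ∧
      ∀ p : List (List α), 𝒜 p = TupleLearning.learnerGrammar f h {w | w ∈ p} :=
  ⟨fun p => TupleLearning.learnerGrammar f h {w | w ∈ p},
    ⟨TupleLearning.computableLearner_learnerGrammar f h hf,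
      fun _ hL _ hw => TupleLearning.exists_language_learnerGrammar_eq hL hw⟩, fun _ => rfl⟩
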